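/- Let $C\subset\mathbb R_+^N$ be a compact convex set containing the simplex $\Sigma=\{x\in\mathbb R^N: x_i\ge 0,\ \sum_i x_i\le 1\}$, let $K\subset\mathbb C^N$ be compact and let $w:K\to[0,\infty)$ be continuous. For $\alpha\in\mathbb Z_+^N$ put $r(\alpha)=\inf\{r\ge 0:\alpha\in rC\}$. Write $\alpha\prec\beta$ if $|\alpha|<|\beta|$, or if $|\alpha|=|\beta|$ and there is $i$ with $\alpha_i<\beta_i$ and $\alpha_j=\beta_j$ for all $j<i$. Write $\alpha\prec_C\beta$ if $r(\alpha)<r(\beta)$, or if $r(\alpha)=r(\beta)$ and $\alpha\prec\beta$. For $k\in\mathbb Z_+$ and $\alpha\in kC\cap\mathbb Z^N$ let $\mathcal M^C_k(\alpha)$ be the set of polynomials $z^\alpha+\sum a_\beta z^\beta$ with complex $a_\beta$, the sum being over the $\beta\in kC\cap\mathbb Z^N$ with $\beta\prec_C\alpha$, and for $k\ge1$ let $$T^C_k(\alpha)=\inf\Bigl\{\sup_{z\in K}w(z)^k|p(z)| : p\in\mathcal M^C_k(\alpha)\Bigr\}^{1/k}.$$ Let $M_k$ be the number of points $\alpha(1),\dots,\alpha(M_k)$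 of $kC\cap\mathbb Z^N$ and let $$V_k=\sup\Bigl\{\bigl|\det[w(\zeta_l)^k\zeta_l^{\alpha(j)}]_{j,l=1}^{M_k}\bigr| : \zeta_1,\dots,\zeta_{M_k}\in K\Bigr\}.$$ Assume that $C$ satisfies the condition $(\dag)$ for all $k,l\in\mathbb Z_+$, all $\alpha\in kC\cap\mathbb Z^N$ and all $p\in\mathcal M^C_k(\alpha)$ there is $j_0$ such that $z^\delta p^j\in\mathcal M^C_{jk+l}(j\alpha+\delta)$ for all $\delta\in lC\cap\mathbb Z^N$ and all $j\ge j_0$. Then the limit $D^w(K)=\lim_{k\to\infty}V_k^{1/(kM_k)}$ exists. Moreover, whenever the directional limit $$T^w_C(K,\theta)=\lim_{k\to\infty,\ \alpha\in kC\cap\mathbb Z^N,\ \alpha/k\to\theta}T^C_k(\alpha)$$ exists for almost every $\theta\in\mathrm{int}(C)$, one has $$D^w(K)=\exp\left(\frac1{\mathrm{vol}_N(C)}\int_{\mathrm{int}(C)}\log T^w_C(K,\theta)\,d\theta\right),$$ where $\log 0=-\infty$, the integral takes values in $[-\infty,\infty)$, and $\exp(-\infty)=0$. -/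

import Mathlib

open Filter Topology MeasureTheory
open scoped Pointwise ENNReal

namespace CPluri

variable {N : ℕ}

/-- The exponent `α ∈ ℤ₊^N`, viewed as a point of `ℝ^N`. -/
def expPt (α : Fin N →₀ ℕ) : Fin N → ℝ := fun i => (α i : ℝ)

/-- The solid unit simplex `Σ` of `ℝ^N`. -/
def unitSimplex (N : ℕ) : Set (Fin N → ℝ) :=
  {x | (∀ i, 0 ≤ x i) ∧ ∑ i, x i ≤ 1}

/-- The lattice points `kC ∩ ℤ₊^N`. For `C ⊆ ℝ₊^N` this is `kC ∩ ℤ^N`. -/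
def latticePts (C : ConvexBody (Fin N → ℝ)) (k : ℕ) : Set (Fin N →₀ ℕ) :=
  {α | expPt α ∈ (k : ℝ) • (C : Set (Fin N → ℝ))}

theorem latticePts_finite (C : ConvexBody (Fin N → ℝ)) (k : ℕ) : (latticePts C k).Finite := by
  have hb : Bornology.IsBounded ((k : ℝ) • (C : Set (Fin N → ℝ))) :=
    (C.isCompact.smul (k : ℝ)).isBounded
  obtain ⟨R, hR⟩ := hb.exists_norm_le
  refine (Set.finite_Iic (Finsupp.equivFunOnFinite.symm (fun _ : Fin N => ⌈R⌉₊))).subset ?_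
  intro α hα i
  have h1 : ‖expPt α i‖ ≤ R := (norm_le_pi_norm _ i).trans (hR _ hα)
  have h2 : ((α i : ℕ) : ℝ) ≤ R := by simpa [expPt] using h1
  have h3 : ((α i : ℕ) : ℝ) ≤ (⌈R⌉₊ : ℕ) := h2.trans (Nat.le_ceil R)
  simpa using (Nat.cast_le (α := ℝ)).1 h3

noncomputable instance (C : ConvexBody (Fin N → ℝ)) (k : ℕ) : Fintype (latticePts C k) :=
  (latticePts_finite C k).fintype

/-- `M_k`, the number of lattice points of `kC`. -/
noncomputable def numPts (C : ConvexBody (Fin N → ℝ)) (k : ℕ) : ℕ :=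
  Fintype.card (latticePts C k)

/-- The grevlex order `α ≺ β`: first compare total degrees, then break ties at the first
coordinate in which the exponents differ. -/
def grevlexLT (α β : Fin N →₀ ℕ) : Prop :=
  ∑ i, α i < ∑ i, β i ∨
    (∑ i, α i = ∑ i, β i ∧ ∃ i, α i < β i ∧ ∀ j, j < i → α j = β j)

/-- `r(α) = inf {r ≥ 0 : α ∈ rC}`. -/
noncomputable def rC (C : ConvexBody (Fin N → ℝ)) (α : Fin N →₀ ℕ) : ℝ :=
  sInf {r : ℝ | 0 ≤ r ∧ expPt α ∈ r • (C : Set (Fin N → ℝ))}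

/-- The `C`-adapted order `α ≺_C β`. -/
def ordCLT (C : ConvexBody (Fin N → ℝ)) (α β : Fin N →₀ ℕ) : Prop :=
  rC C α < rC C β ∨ (rC C α = rC C β ∧ grevlexLT α β)

/-- The class `M_k^C(α)` of polynomials `z^α + ∑ a_β z^β`, the sum being over the
`β ∈ kC ∩ ℤ^N` with `β ≺_C α`. -/
def monicC (C : ConvexBody (Fin N → ℝ)) (k : ℕ) (α : Fin N →₀ ℕ) :
    Set (MvPolynomial (Fin N) ℂ) :=
  {p | p.coeff α = 1 ∧ ∀ β ∈ p.support, β ≠ α → β ∈ latticePts C k ∧ ordCLT C β α}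

/-- Condition (†) on the convex body `C`. -/
def Dagger (C : ConvexBody (Fin N → ℝ)) : Prop :=
  ∀ (k l : ℕ), ∀ α ∈ latticePts C k, ∀ p ∈ monicC C k α, ∃ j₀ : ℕ,
    ∀ δ ∈ latticePts C l, ∀ j : ℕ, j₀ ≤ j →
      MvPolynomial.monomial δ 1 * p ^ j ∈ monicC C (j * k + l) (j • α + δ)

/-- The weighted sup norm `ν_k(p) = ‖w^k p‖_K`. -/
noncomputable def wNorm (K : Set (Fin N → ℂ)) (w : (Fin N → ℂ) → ℝ) (k : ℕ)
    (p : MvPolynomial (Fin N) ℂ) : ℝ :=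
  ⨆ z : K, w z ^ k * ‖MvPolynomial.eval (z : Fin N → ℂ) p‖

/-- The discrete Chebyshev constant `T_k^C(ν_k, α)`. -/
noncomputable def chebC (C : ConvexBody (Fin N → ℝ)) (K : Set (Fin N → ℂ))
    (w : (Fin N → ℂ) → ℝ) (k : ℕ) (α : Fin N →₀ ℕ) : ℝ :=
  (sInf (wNorm K w k '' monicC C k α)) ^ ((1 : ℝ) / k)

/-- The mode of convergence `k → ∞`, `α ∈ kC ∩ ℤ^N`, `α / k → θ` of the pairs `(k, α)`. -/
noncomputable def dirFilter (C : ConvexBody (Fin N → ℝ)) (θ : Fin N → ℝ) : Filter (ℕ × (Fin N →₀ ℕ)) :=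
  comap Prod.fst atTop ⊓ comap (fun x => (x.1 : ℝ)⁻¹ • expPt x.2) (𝓝 θ) ⊓
    𝓟 {x | x.2 ∈ latticePts C x.1}

/-- `t` is the directional Chebyshev constant `T_C^w(K, θ)`: the limit of `T_k^C(ν_k, α)` as
`k → ∞`, `α / k → θ` exists and equals `t`. -/
def IsDirChebC (C : ConvexBody (Fin N → ℝ)) (K : Set (Fin N → ℂ)) (w : (Fin N → ℂ) → ℝ)
    (θ : Fin N → ℝ) (t : ℝ) : Prop :=
  Tendsto (fun x : ℕ × (Fin N →₀ ℕ) => chebC C K w x.1 x.2) (dirFilter C θ) (𝓝 t)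

/-- The weighted Vandermonde determinant of order `k` of a family of `M_k` points, with the
points and the monomials both indexed by `kC ∩ ℤ^N`. Another enumeration changes at most the
sign. -/
noncomputable def vdm (C : ConvexBody (Fin N → ℝ)) (w : (Fin N → ℂ) → ℝ) (k : ℕ)
    (ζ : latticePts C k → (Fin N → ℂ)) : ℂ :=
  (Matrix.of fun a b : latticePts C k =>
    ((w (ζ b) ^ k : ℝ) : ℂ) * ∏ i, ζ b i ^ (a : Fin N →₀ ℕ) i).det

/-- `V_k^w(K, M_k)`, the supremum of `|VDM_k^w|` over all families of `M_k` points of `K`. -/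
noncomputable def vdmSup (C : ConvexBody (Fin N → ℝ)) (K : Set (Fin N → ℂ))
    (w : (Fin N → ℂ) → ℝ) (k : ℕ) : ℝ :=
  ⨆ ζ : latticePts C k → K, ‖vdm C w k (fun a => (ζ a : Fin N → ℂ))‖

/-- The logarithm of a real number `t ≥ 0`, with `log 0 = -∞`. -/
noncomputable def elog (t : ℝ) : EReal := ENNReal.log (ENNReal.ofReal t)

/-- The integral of an extended real valued function, as the integral of its positive part minus
that of its negative part. It takes values in `[-∞, ∞)` when the positive part has a finite
integral, for instance when the function is bounded above and the measure is finite. -/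
noncomputable def eintegral (μ : Measure (Fin N → ℝ)) (f : (Fin N → ℝ) → EReal) : EReal :=
  ((∫⁻ θ, (f θ).toENNReal ∂μ : ℝ≥0∞) : EReal) - ((∫⁻ θ, (-f θ).toENNReal ∂μ : ℝ≥0∞) : EReal)

end CPluri

/-!
The Vandermonde determinant of order `k` does not depend on how the exponents in `kC` are ordered,
but every total order of them turns it into a product: up to a factor `M_k!`, which disappears
after the normalization, `V_k` is the product over `α` in `kC` of the smallest weighted norm of a
polynomial with leading exponent `α` for that order (`prod_minNorm_le_vdmSup`,
`vdmSup_le_prod_minNorm`). An order is encoded by an injective key with values in a linear order,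
and the proof uses three kinds of keys.

*Orders compatible with addition* (`linKey`). Leading terms multiply, so the smallest norms are
submultiplicative on the semigroup of the pairs `(k, α)`. Placing `q ^ N` copies of `q • (mC)` in
`kC` gives a Fekete inequality for the whole product (`prod_minNorm_div_le_pow`), and the limit `D`
exists (`exists_tendsto_vdmSup`).

*The order `≺_C`* (`keyC`). The logarithm of the product is a lattice sum of `log T_k(α)`, that is,
the integral of a step function. If `D > 0`, these step functions are uniformly bounded and
dominated convergence gives the formula (`limit_eq_exp_integral`). The lower bound is the main
point. Since `r` is convex and ties are broken lexicographically, the leading exponent of a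
polynomial for `≺_C` is a vertex of its Newton polytope (`expPt_notMem_convexHull`), hence its
leading exponent for some order compatible with addition. Then the multiples of a power of a
polynomial of very small norm would replace a positive proportion of the monomials in the upper
bound for `V_k`, and make `D` smaller than it is (`mul_pow_le_wNorm`).

*The order `≺_C` shifted by `δ`*, `α ↦ keyC C (α + δ)`. If `D = 0`, the directional constants
vanish: let `T(θ) > 0` and let `δ` be close to `skθ` with `s` large. For `α` in `kC`, the
directions of all the `α + δ` are close to `θ`, so their Chebyshev constants are bounded below,
hence so are the smallest norms at `α` for the shifted order, and so is the normalized `V_k`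
(`limit_pos_of_isDirChebC`). Thus both sides of the formula are zero.
-/

namespace CPluri

variable {N : ℕ}

/-! ### Lattice points of dilates of `C` -/

section Lattice

variable {C : ConvexBody (Fin N → ℝ)}

theorem expPt_add (α β : Fin N →₀ ℕ) : expPt (α + β) = expPt α + expPt β := by
  ext i; simp [expPt]

theorem expPt_nsmul (j : ℕ) (α : Fin N →₀ ℕ) : expPt (j • α) = (j : ℝ) • expPt α := by
  ext i; simp [expPt]

theorem expPt_injective : Function.Injective (expPt (N := N)) := by
  intro α β h
  ext i
  have := congrFun h i
  simpa [expPt] using this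

theorem add_mem_latticePts {k l : ℕ} {α β : Fin N →₀ ℕ} (hα : α ∈ latticePts C k)
    (hβ : β ∈ latticePts C l) : α + β ∈ latticePts C (k + l) := by
  simp only [latticePts, Set.mem_ofPred_eq] at *
  rw [expPt_add, Nat.cast_add, C.convex.add_smul (Nat.cast_nonneg k) (Nat.cast_nonneg l)]
  exact Set.add_mem_add hα hβ

theorem nsmul_mem_latticePts {k : ℕ} {α : Fin N →₀ ℕ} (j : ℕ) (hα : α ∈ latticePts C k) :
    j • α ∈ latticePts C (j * k) := by
  simp only [latticePts, Set.mem_ofPred_eq] at *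
  rw [expPt_nsmul, Nat.cast_mul, mul_smul]
  exact Set.smul_mem_smul_set hα

theorem mem_latticePts_iff {k : ℕ} (hk : k ≠ 0) {α : Fin N →₀ ℕ} :
    α ∈ latticePts C k ↔ (k : ℝ)⁻¹ • expPt α ∈ C := by
  have : (k : ℝ) ≠ 0 := Nat.cast_ne_zero.2 hk
  simp only [latticePts, Set.mem_ofPred_eq]
  rw [Set.mem_smul_set_iff_inv_smul_mem₀ this]
  rfl

theorem mem_latticePts_of_sum_le (hSigma : unitSimplex N ⊆ (C : Set (Fin N → ℝ)))
    {k : ℕ} {α : Fin N →₀ ℕ} (h : ∑ i, α i ≤ k) : α ∈ latticePts C k := by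
  rcases Nat.eq_zero_or_pos k with rfl | hk
  · have h0 : α = 0 := by
      ext i
      have := Finset.single_le_sum (f := fun i => α i) (fun i _ => Nat.zero_le _)
        (Finset.mem_univ i)
      simp only [Finsupp.coe_zero, Pi.zero_apply]
      omega
    have hz : (0 : Fin N → ℝ) ∈ (C : Set (Fin N → ℝ)) := hSigma ⟨by simp, by simp⟩
    refine ⟨0, hz, ?_⟩
    ext i; simp [h0, expPt]
  · rw [mem_latticePts_iff hk.ne']
    have hk' : (0 : ℝ) < k := Nat.cast_pos.2 hk
    refine hSigma ⟨fun i => by simp only [expPt, Pi.smul_apply, smul_eq_mul]; positivity, ?_⟩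
    simp only [expPt, Pi.smul_apply, smul_eq_mul]
    rw [← Finset.mul_sum, inv_mul_le_iff₀ hk', mul_one]
    exact_mod_cast h

theorem zero_mem_latticePts (hSigma : unitSimplex N ⊆ (C : Set (Fin N → ℝ))) (k : ℕ) :
    (0 : Fin N →₀ ℕ) ∈ latticePts C k :=
  mem_latticePts_of_sum_le hSigma (by simp)

theorem numPts_pos (hSigma : unitSimplex N ⊆ (C : Set (Fin N → ℝ))) (k : ℕ) :
    0 < numPts C k :=
  Fintype.card_pos_iff.2 ⟨⟨0, zero_mem_latticePts hSigma k⟩⟩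

theorem exists_sum_le_of_mem_latticePts (C : ConvexBody (Fin N → ℝ)) :
    ∃ R : ℕ, ∀ k : ℕ, ∀ α ∈ latticePts C k, ∑ i, α i ≤ R * k := by
  obtain ⟨B, hB⟩ := C.isCompact.isBounded.exists_norm_le
  refine ⟨⌈∑ _i : Fin N, B⌉₊, ?_⟩
  rintro k α ⟨x, hx, hxα⟩
  have h1 : ∀ i, (α i : ℝ) ≤ k * B := by
    intro i
    have h2 : (k : ℝ) * x i = α i := congrFun hxα i
    rw [← h2]
    exact mul_le_mul_of_nonneg_left
      ((le_abs_self _).trans ((norm_le_pi_norm x i).trans (hB x hx))) (Nat.cast_nonneg k)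
  have h3 : ((∑ i, α i : ℕ) : ℝ) ≤ (∑ _i : Fin N, B) * k := by
    push_cast
    rw [Finset.sum_mul]
    exact Finset.sum_le_sum fun i _ => (h1 i).trans_eq (mul_comm _ _)
  have h4 : (∑ _i : Fin N, B) * (k : ℝ) ≤ (⌈∑ _i : Fin N, B⌉₊ : ℝ) * k :=
    mul_le_mul_of_nonneg_right (Nat.le_ceil _) (Nat.cast_nonneg k)
  exact_mod_cast h3.trans h4

end Lattice

/-! ### Weighted sup norms -/

section Norm

variable {K : Set (Fin N → ℂ)} {w : (Fin N → ℂ) → ℝ}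

theorem continuousOn_weighted (hw : ContinuousOn w K) (k : ℕ) (p : MvPolynomial (Fin N) ℂ) :
    ContinuousOn (fun z => w z ^ k * ‖MvPolynomial.eval z p‖) K :=
  (hw.pow k).mul (MvPolynomial.continuous_eval p).norm.continuousOn

theorem bddAbove_weighted (hK : IsCompact K) (hw : ContinuousOn w K) (k : ℕ)
    (p : MvPolynomial (Fin N) ℂ) :
    BddAbove (Set.range fun z : K => w z ^ k * ‖MvPolynomial.eval (z : Fin N → ℂ) p‖) := by
  have := hK.bddAbove_image (continuousOn_weighted hw k p)
  rwa [Set.image_eq_range] at this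

theorem le_wNorm (hK : IsCompact K) (hw : ContinuousOn w K) (k : ℕ)
    (p : MvPolynomial (Fin N) ℂ) {z : Fin N → ℂ} (hz : z ∈ K) :
    w z ^ k * ‖MvPolynomial.eval z p‖ ≤ wNorm K w k p :=
  le_ciSup (bddAbove_weighted hK hw k p) ⟨z, hz⟩

theorem wNorm_nonneg (hw0 : ∀ z ∈ K, 0 ≤ w z) (k : ℕ) (p : MvPolynomial (Fin N) ℂ) :
    0 ≤ wNorm K w k p :=
  Real.iSup_nonneg fun z => mul_nonneg (pow_nonneg (hw0 z z.2) k) (norm_nonneg _)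

theorem wNorm_le (k : ℕ) (p : MvPolynomial (Fin N) ℂ) {b : ℝ} (hb : 0 ≤ b)
    (h : ∀ z ∈ K, w z ^ k * ‖MvPolynomial.eval z p‖ ≤ b) : wNorm K w k p ≤ b :=
  Real.iSup_le (fun z => h z z.2) hb

theorem exists_wNorm_eq (hK : IsCompact K) (hne : K.Nonempty) (hw : ContinuousOn w K) (k : ℕ)
    (p : MvPolynomial (Fin N) ℂ) :
    ∃ z : K, wNorm K w k p = w z ^ k * ‖MvPolynomial.eval (z : Fin N → ℂ) p‖ := by
  obtain ⟨z, hz, hmax⟩ := hK.exists_isMaxOn hne (continuousOn_weighted hw k p)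
  have : Nonempty K := ⟨⟨z, hz⟩⟩
  exact ⟨⟨z, hz⟩, le_antisymm (ciSup_le fun y => hmax y.2) (le_wNorm hK hw k p hz)⟩

theorem wNorm_mul_le (hK : IsCompact K) (hw : ContinuousOn w K) (hw0 : ∀ z ∈ K, 0 ≤ w z)
    (k l : ℕ) (p q : MvPolynomial (Fin N) ℂ) :
    wNorm K w (k + l) (p * q) ≤ wNorm K w k p * wNorm K w l q := by
  refine wNorm_le _ _ (mul_nonneg (wNorm_nonneg hw0 _ _) (wNorm_nonneg hw0 _ _)) fun z hz => ?_
  have h : w z ^ (k + l) * ‖MvPolynomial.eval z (p * q)‖ =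
      (w z ^ k * ‖MvPolynomial.eval z p‖) * (w z ^ l * ‖MvPolynomial.eval z q‖) := by
    rw [map_mul, norm_mul, pow_add]; ring
  rw [h]
  exact mul_le_mul (le_wNorm hK hw k p hz) (le_wNorm hK hw l q hz)
    (mul_nonneg (pow_nonneg (hw0 z hz) l) (norm_nonneg _)) (wNorm_nonneg hw0 _ _)

theorem wNorm_pow_le (hK : IsCompact K) (hw : ContinuousOn w K) (hw0 : ∀ z ∈ K, 0 ≤ w z)
    (k : ℕ) (p : MvPolynomial (Fin N) ℂ) (j : ℕ) :
    wNorm K w (j * k) (p ^ j) ≤ wNorm K w k p ^ j := by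
  induction j with
  | zero => exact wNorm_le _ _ (by simp) (fun z _ => by simp)
  | succ j ih =>
    rw [Nat.succ_mul, pow_succ, pow_succ]
    exact (wNorm_mul_le hK hw hw0 _ _ _ _).trans
      (mul_le_mul_of_nonneg_right ih (wNorm_nonneg hw0 _ _))

/-- The monomials with exponents in `kC` have norms of at most exponential growth. -/
theorem exists_wNorm_monomial_le (C : ConvexBody (Fin N → ℝ)) (hK : IsCompact K)
    (hw : ContinuousOn w K) (hw0 : ∀ z ∈ K, 0 ≤ w z) :
    ∃ A : ℝ, 1 ≤ A ∧ ∀ k : ℕ, ∀ α ∈ latticePts C k,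
      wNorm K w k (MvPolynomial.monomial α 1) ≤ A ^ k := by
  obtain ⟨R, hR⟩ := exists_sum_le_of_mem_latticePts C
  obtain ⟨Z, hZ⟩ := hK.isBounded.exists_norm_le
  obtain ⟨W, hW⟩ := hK.exists_bound_of_continuousOn hw
  set Z' := max Z 1
  set W' := max W 1
  have hZ1 : 1 ≤ Z' := le_max_right _ _
  have hW1 : 1 ≤ W' := le_max_right _ _
  refine ⟨W' * Z' ^ R, one_le_mul_of_one_le_of_one_le hW1 (one_le_pow₀ hZ1), fun k α hα => ?_⟩
  refine wNorm_le _ _ (by positivity) fun z hz => ?_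
  rw [mul_pow, ← pow_mul]
  refine mul_le_mul (pow_le_pow_left₀ (hw0 z hz)
    (((le_abs_self _).trans (hW z hz)).trans (le_max_left _ _)) k) ?_ (norm_nonneg _) (by positivity)
  rw [MvPolynomial.eval_monomial, one_mul, Finsupp.prod_fintype _ _ (by simp), norm_prod]
  calc ∏ i, ‖z i ^ α i‖ ≤ ∏ i, Z' ^ α i := by
        refine Finset.prod_le_prod (fun i _ => norm_nonneg _) fun i _ => ?_
        rw [norm_pow]
        exact pow_le_pow_left₀ (norm_nonneg _)
          (((norm_le_pi_norm z i).trans (hZ z hz)).trans (le_max_left _ _)) _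
    _ = Z' ^ (∑ i, α i) := Finset.prod_pow_eq_pow_sum _ _ _
    _ ≤ Z' ^ (R * k) := pow_le_pow_right₀ hZ1 (hR k α hα)

end Norm

/-! ### Monic polynomials and Chebyshev constants for an arbitrary order -/

section Monic

variable {G : Type*} [LinearOrder G]

/-- The polynomials `z^α + ∑ a_β z^β`, the sum being over the `β ∈ kC ∩ ℤ^N` with `e β < e α`.
The injective key `e` with values in a linear order encodes a total order on the exponents. -/
def monicFor (C : ConvexBody (Fin N → ℝ)) (e : (Fin N →₀ ℕ) → G) (k : ℕ) (α : Fin N →₀ ℕ) :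
    Set (MvPolynomial (Fin N) ℂ) :=
  {p | p.coeff α = 1 ∧ ∀ β ∈ p.support, β ≠ α → β ∈ latticePts C k ∧ e β < e α}

/-- The smallest weighted norm of a polynomial in `monicFor C e k α`. No `k`-th root is taken. -/
noncomputable def minNorm (C : ConvexBody (Fin N → ℝ)) (K : Set (Fin N → ℂ))
    (w : (Fin N → ℂ) → ℝ) (e : (Fin N →₀ ℕ) → G) (k : ℕ) (α : Fin N →₀ ℕ) : ℝ :=
  sInf (wNorm K w k '' monicFor C e k α)

variable {C : ConvexBody (Fin N → ℝ)} {K : Set (Fin N → ℂ)} {w : (Fin N → ℂ) → ℝ}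
  {e : (Fin N →₀ ℕ) → G}

theorem monomial_mem_monicFor (k : ℕ) (α : Fin N →₀ ℕ) :
    MvPolynomial.monomial α 1 ∈ monicFor C e k α := by
  refine ⟨by simp, fun β hβ hne => ?_⟩
  rw [MvPolynomial.mem_support_iff, MvPolynomial.coeff_monomial, if_neg (Ne.symm hne)] at hβ
  exact absurd rfl hβ

theorem bddBelow_wNorm_monicFor (hw0 : ∀ z ∈ K, 0 ≤ w z) (k : ℕ) (α : Fin N →₀ ℕ) :
    BddBelow (wNorm K w k '' monicFor C e k α) :=
  ⟨0, by rintro _ ⟨p, _, rfl⟩; exact wNorm_nonneg hw0 _ _⟩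

theorem minNorm_nonneg (hw0 : ∀ z ∈ K, 0 ≤ w z) (k : ℕ) (α : Fin N →₀ ℕ) :
    0 ≤ minNorm C K w e k α :=
  Real.sInf_nonneg (by rintro _ ⟨p, _, rfl⟩; exact wNorm_nonneg hw0 _ _)

theorem minNorm_le (hw0 : ∀ z ∈ K, 0 ≤ w z) {k : ℕ} {α : Fin N →₀ ℕ}
    {p : MvPolynomial (Fin N) ℂ} (hp : p ∈ monicFor C e k α) :
    minNorm C K w e k α ≤ wNorm K w k p :=
  csInf_le (bddBelow_wNorm_monicFor hw0 k α) ⟨p, hp, rfl⟩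

theorem minNorm_mem_closure (hw0 : ∀ z ∈ K, 0 ≤ w z) (k : ℕ) (α : Fin N →₀ ℕ) :
    minNorm C K w e k α ∈ closure (wNorm K w k '' monicFor C e k α) :=
  csInf_mem_closure ⟨_, _, monomial_mem_monicFor k α, rfl⟩ (bddBelow_wNorm_monicFor hw0 k α)

/-- An inequality between a constant and a continuous function of the norm of every monic
polynomial passes to the smallest norm. -/
theorem le_of_forall_monicFor (hw0 : ∀ z ∈ K, 0 ≤ w z) {k : ℕ} {α : Fin N →₀ ℕ} {x : ℝ}
    {g : ℝ → ℝ} (hg : Continuous g) (h : ∀ p ∈ monicFor C e k α, x ≤ g (wNorm K w k p)) :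
    x ≤ g (minNorm C K w e k α) := by
  have hcl : IsClosed {y | x ≤ g y} := isClosed_le continuous_const hg
  have hsub : wNorm K w k '' monicFor C e k α ⊆ {y | x ≤ g y} := by
    rintro _ ⟨p, hp, rfl⟩; exact h p hp
  exact closure_minimal hsub hcl (minNorm_mem_closure hw0 k α)

theorem minNorm_le_pow (hw0 : ∀ z ∈ K, 0 ≤ w z) {A : ℝ}
    (hA : ∀ k : ℕ, ∀ α ∈ latticePts C k, wNorm K w k (MvPolynomial.monomial α 1) ≤ A ^ k)
    {k : ℕ} {α : Fin N →₀ ℕ} (hα : α ∈ latticePts C k) : minNorm C K w e k α ≤ A ^ k :=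
  (minNorm_le hw0 (monomial_mem_monicFor k α)).trans (hA k α hα)

theorem mem_latticePts_of_mem_support {k : ℕ} {α β : Fin N →₀ ℕ} {p : MvPolynomial (Fin N) ℂ}
    (hα : α ∈ latticePts C k) (hp : p ∈ monicFor C e k α) (hβ : β ∈ p.support) :
    β ∈ latticePts C k := by
  by_cases h : β = α
  · rwa [h]
  · exact (hp.2 β hβ h).1

theorem key_le_of_mem_support {k : ℕ} {α β : Fin N →₀ ℕ} {p : MvPolynomial (Fin N) ℂ}
    (hp : p ∈ monicFor C e k α) (hβ : β ∈ p.support) : e β ≤ e α := by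
  by_cases h : β = α
  · rw [h]
  · exact (hp.2 β hβ h).2.le

/-- For an order that is compatible with addition, leading terms multiply. -/
theorem mul_mem_monicFor (hadd : ∀ a b c, e a < e b → e (a + c) < e (b + c))
    {k l : ℕ} {α β : Fin N →₀ ℕ}
    {p q : MvPolynomial (Fin N) ℂ} (hα : α ∈ latticePts C k) (hβ : β ∈ latticePts C l)
    (hp : p ∈ monicFor C e k α) (hq : q ∈ monicFor C e l β) :
    p * q ∈ monicFor C e (k + l) (α + β) := by
  classical
  have key : ∀ a ∈ p.support, ∀ b ∈ q.support, (a, b) ≠ (α, β) → e (a + b) < e (α + β) := by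
    intro a ha b hb hne
    by_cases h : a = α
    · have hb' : b ≠ β := fun hb' => hne (by rw [h, hb'])
      have := hadd b β α (hq.2 b hb hb').2
      rwa [h, add_comm α b, add_comm α β]
    · refine (hadd a α b (hp.2 a ha h).2).trans_le ?_
      by_cases h' : b = β
      · rw [h']
      · have := hadd b β α (hq.2 b hb h').2
        rw [add_comm α b, add_comm α β]
        exact this.le
  refine ⟨?_, fun γ hγ hne => ?_⟩
  · rw [MvPolynomial.coeff_mul, Finset.sum_eq_single (α, β)]
    · rw [hp.1, hq.1, one_mul]
    · rintro ⟨a, b⟩ hab hne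
      rw [Finset.HasAntidiagonal.mem_antidiagonal] at hab
      by_contra h0
      have ha : a ∈ p.support := MvPolynomial.mem_support_iff.2 (left_ne_zero_of_mul h0)
      have hb : b ∈ q.support := MvPolynomial.mem_support_iff.2 (right_ne_zero_of_mul h0)
      have := key a ha b hb hne
      simp only at hab
      rw [hab] at this
      exact lt_irrefl _ this
    · intro h
      exact absurd (by rw [Finset.HasAntidiagonal.mem_antidiagonal]) h
  · obtain ⟨a, ha, b, hb, rfl⟩ := Finset.mem_add.1 (MvPolynomial.support_mul p q hγ)
    refine ⟨add_mem_latticePts (mem_latticePts_of_mem_support hα hp ha)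
      (mem_latticePts_of_mem_support hβ hq hb), key a ha b hb ?_⟩
    intro h
    rw [Prod.mk.injEq] at h
    exact hne (by rw [h.1, h.2])

theorem pow_mem_monicFor
    (hadd : ∀ a b c, e a < e b → e (a + c) < e (b + c))
    {k : ℕ} {α : Fin N →₀ ℕ} {p : MvPolynomial (Fin N) ℂ} (hα : α ∈ latticePts C k)
    (hp : p ∈ monicFor C e k α) (j : ℕ) : p ^ j ∈ monicFor C e (j * k) (j • α) := by
  induction j with
  | zero =>
    have := monomial_mem_monicFor (C := C) (e := e) (0 * k) (0 : Fin N →₀ ℕ)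
    rw [pow_zero, zero_smul]
    simpa using this
  | succ j ih =>
    rw [pow_succ, Nat.succ_mul, succ_nsmul]
    exact mul_mem_monicFor hadd (nsmul_mem_latticePts j hα) hα ih hp

end Monic

/-! ### Vandermonde determinants and products of Chebyshev constants -/

section Det

/-- If `φ i + ∑_{j < i} c_j φ j` always reaches the value `t i` in modulus, then the determinant
`det (φ i (ζ j))` reaches `∏ t i`: the points are chosen one at a time, and the expansion of the
determinant along its last column is the leading minor times such a combination. -/
theorem exists_prod_le_norm_det {X : Type*} [Nonempty X] (n : ℕ) (φ : Fin n → X → ℂ)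
    (t : Fin n → ℝ) (ht : ∀ i, 0 ≤ t i)
    (h : ∀ i, ∀ c : Fin n → ℂ, c i = 1 → (∀ j, i < j → c j = 0) →
      ∃ x, t i ≤ ‖∑ j, c j * φ j x‖) :
    ∃ ζ : Fin n → X, ∏ i, t i ≤ ‖(Matrix.of fun i j => φ i (ζ j)).det‖ := by
  induction n with
  | zero => exact ⟨fun i => i.elim0, by simp⟩
  | succ n ih =>
    obtain ⟨ζ, hζ⟩ := ih (fun i => φ i.castSucc) (fun i => t i.castSucc) (fun i => ht _) (by
      intro i c hi hc
      obtain ⟨x, hx⟩ := h i.castSucc (Fin.snoc c 0) (by simpa using hi) (by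
        intro j
        refine Fin.lastCases (by simp) (fun j hj => ?_) j
        simpa using hc j (by simpa using hj))
      refine ⟨x, hx.trans_eq ?_⟩
      rw [Fin.sum_univ_castSucc]
      simp)
    set d := (Matrix.of fun i j => φ (Fin.castSucc i) (ζ j)).det with hd
    rw [Fin.prod_univ_castSucc]
    by_cases h0 : d = 0
    · have : ∏ i : Fin n, t i.castSucc = 0 := by
        refine le_antisymm (hζ.trans (by simp [h0])) (Finset.prod_nonneg fun i _ => ht _)
      exact ⟨fun _ => Classical.arbitrary X, by rw [this, zero_mul]; exact norm_nonneg _⟩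
    -- the cofactors of the last column, which do not depend on the last point
    set c : Fin (n + 1) → ℂ := fun i => (-1) ^ ((i : ℕ) + n) *
      (Matrix.of fun (a b : Fin n) => φ (i.succAbove a) (ζ b)).det with hc
    have hclast : c (Fin.last n) = d := by
      simp only [hc, hd, Fin.val_last, Fin.succAbove_last]
      rw [← two_mul, pow_mul]; simp
    obtain ⟨x, hx⟩ := h (Fin.last n) (fun i => c i / d) (by simp only [hclast]; exact div_self h0)
      (fun j hj => absurd (Fin.le_last j) (not_le.2 hj))
    refine ⟨Fin.snoc ζ x, ?_⟩
    have hdet : (Matrix.of fun i j => φ i ((Fin.snoc ζ x : Fin (n + 1) → X) j)).det =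
        d * ∑ j, c j / d * φ j x := by
      rw [Matrix.det_succ_column _ (Fin.last n), Finset.mul_sum]
      refine Finset.sum_congr rfl fun i _ => ?_
      have hsub : ((Matrix.of fun i j => φ i ((Fin.snoc ζ x : Fin (n + 1) → X) j)).submatrix
          i.succAbove (Fin.last n).succAbove) =
          Matrix.of fun (a b : Fin n) => φ (i.succAbove a) (ζ b) := by
        ext a b
        simp [Fin.succAbove_last]
      rw [hsub]
      simp only [Matrix.of_apply, Fin.snoc_last, Fin.val_last, hc]
      field_simp
    rw [hdet, norm_mul]
    exact mul_le_mul hζ hx (ht _) (norm_nonneg _)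

/-- The determinant of a matrix is at most `n!` times the product of bounds for its rows. -/
theorem norm_det_le_factorial_mul_prod {ι : Type*} [Fintype ι] [DecidableEq ι]
    (M : Matrix ι ι ℂ) (b : ι → ℝ) (h : ∀ i j, ‖M i j‖ ≤ b i) :
    ‖M.det‖ ≤ (Fintype.card ι).factorial * ∏ i, b i := by
  rw [Matrix.det_apply]
  refine (norm_sum_le _ _).trans ?_
  have : ∀ σ ∈ (Finset.univ : Finset (Equiv.Perm ι)),
      ‖Equiv.Perm.sign σ • ∏ i, M (σ i) i‖ ≤ ∏ i, b i := by
    intro σ _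
    have h1 : ‖Equiv.Perm.sign σ • ∏ i, M (σ i) i‖ = ∏ i, ‖M (σ i) i‖ := by
      rcases Int.units_eq_one_or (Equiv.Perm.sign σ) with h | h <;> simp [h]
    rw [h1, ← Equiv.prod_comp σ b]
    exact Finset.prod_le_prod (fun i _ => norm_nonneg _) fun i _ => h _ _
  refine (Finset.sum_le_card_nsmul _ _ _ this).trans_eq ?_
  rw [Finset.card_univ, Fintype.card_perm, nsmul_eq_mul]

variable {G : Type*} [LinearOrder G]

/-- A matrix that is unitriangular for some total order of the indices has determinant `1`. -/
theorem det_eq_one_of_key {ι : Type*} [Fintype ι] [DecidableEq ι] {f : ι → G}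
    (hf : Function.Injective f) (M : Matrix ι ι ℂ) (hdiag : ∀ a, M a a = 1)
    (hlow : ∀ a b, M a b ≠ 0 → f b ≤ f a) : M.det = 1 := by
  let _ : LinearOrder ι := LinearOrder.lift' f hf
  have htri : M.transpose.IsUpperTriangular := by
    intro a b hab
    by_contra hne
    exact absurd (hlow b a hne) (not_le.2 (show f b < f a from hab))
  rw [← Matrix.det_transpose, Matrix.det_of_isUpperTriangular htri]
  exact Finset.prod_eq_one fun a _ => hdiag a

theorem exists_equiv_fin_of_key {ι : Type*} [Fintype ι] {f : ι → G}
    (hf : Function.Injective f) {n : ℕ} (hn : Fintype.card ι = n) :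
    ∃ o : Fin n ≃ ι, ∀ i j, i < j → f (o i) < f (o j) := by
  let _ : LinearOrder ι := LinearOrder.lift' f hf
  let o := monoEquivOfFin ι hn
  exact ⟨o.toEquiv, fun i j hij => (o.lt_iff_lt.2 hij : o i < o j)⟩

variable {C : ConvexBody (Fin N → ℝ)} {K : Set (Fin N → ℂ)} {w : (Fin N → ℂ) → ℝ}
  {e : (Fin N →₀ ℕ) → G}

theorem eval_eq_sum_latticePts {k : ℕ} {p : MvPolynomial (Fin N) ℂ}
    (hp : ∀ β ∈ p.support, β ∈ latticePts C k) (z : Fin N → ℂ) :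
    MvPolynomial.eval z p =
      ∑ a : latticePts C k, p.coeff (a : Fin N →₀ ℕ) * ∏ i, z i ^ (a : Fin N →₀ ℕ) i := by
  classical
  have hs : p.support ⊆ (latticePts C k).toFinset := fun β hβ => by
    rw [Set.mem_toFinset]; exact hp β hβ
  rw [MvPolynomial.eval_eq', Finset.sum_subset hs, Finset.sum_set_coe (latticePts C k)
    (f := fun a => p.coeff a * ∏ i, z i ^ a i)]
  intro x _ hx
  rw [MvPolynomial.notMem_support_iff.1 hx, zero_mul]

/-- Replacing the monomials by polynomials that are monic for some order does not change the
Vandermonde determinant. -/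
theorem vdm_eq_det (he : Function.Injective e) {k : ℕ}
    (f : latticePts C k → MvPolynomial (Fin N) ℂ)
    (hf : ∀ a : latticePts C k, f a ∈ monicFor C e k a) (ζ : latticePts C k → (Fin N → ℂ)) :
    vdm C w k ζ = (Matrix.of fun a b : latticePts C k =>
      ((w (ζ b) ^ k : ℝ) : ℂ) * MvPolynomial.eval (ζ b) (f a)).det := by
  classical
  let U : Matrix (latticePts C k) (latticePts C k) ℂ :=
    Matrix.of fun a b => (f a).coeff (b : Fin N →₀ ℕ)
  have hU : U.det = 1 := by
    refine det_eq_one_of_key (f := fun a : latticePts C k => e a)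
      (fun a b hab => Subtype.ext (he hab)) U (fun a => (hf a).1) fun a b hne => ?_
    exact key_le_of_mem_support (hf a) (MvPolynomial.mem_support_iff.2 hne)
  have hmul : (Matrix.of fun a b : latticePts C k =>
      ((w (ζ b) ^ k : ℝ) : ℂ) * MvPolynomial.eval (ζ b) (f a)) =
      U * Matrix.of fun a b : latticePts C k =>
        ((w (ζ b) ^ k : ℝ) : ℂ) * ∏ i, ζ b i ^ (a : Fin N →₀ ℕ) i := by
    ext a b
    rw [Matrix.mul_apply, Matrix.of_apply, eval_eq_sum_latticePts (C := C) (k := k)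
      (fun β hβ => mem_latticePts_of_mem_support a.2 (hf a) hβ), Finset.mul_sum]
    refine Finset.sum_congr rfl fun x _ => ?_
    simp only [U, Matrix.of_apply]
    ring
  rw [vdm]
  convert_to _ = Matrix.det _
  rw [hmul, Matrix.det_mul, hU, one_mul]

theorem norm_vdm_le (hK : IsCompact K) (hw : ContinuousOn w K) (hw0 : ∀ z ∈ K, 0 ≤ w z)
    (he : Function.Injective e) {k : ℕ}
    (f : latticePts C k → MvPolynomial (Fin N) ℂ)
    (hf : ∀ a : latticePts C k, f a ∈ monicFor C e k a) (ζ : latticePts C k → K) :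
    ‖vdm C w k (fun a => (ζ a : Fin N → ℂ))‖ ≤
      (numPts C k).factorial * ∏ a, wNorm K w k (f a) := by
  rw [vdm_eq_det he f hf]
  refine norm_det_le_factorial_mul_prod _ _ fun a b => ?_
  have hz := hw0 _ (ζ b).2
  rw [Matrix.of_apply, norm_mul, Complex.norm_real, Real.norm_of_nonneg (pow_nonneg hz k)]
  exact le_wNorm hK hw k (f a) (ζ b).2

theorem vdmSup_le_prod_wNorm (hK : IsCompact K) (hw : ContinuousOn w K)
    (hw0 : ∀ z ∈ K, 0 ≤ w z) (he : Function.Injective e) {k : ℕ}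
    (f : latticePts C k → MvPolynomial (Fin N) ℂ)
    (hf : ∀ a : latticePts C k, f a ∈ monicFor C e k a) :
    vdmSup C K w k ≤ (numPts C k).factorial * ∏ a, wNorm K w k (f a) :=
  Real.iSup_le (norm_vdm_le hK hw hw0 he f hf)
    (mul_nonneg (Nat.cast_nonneg _) (Finset.prod_nonneg fun _ _ => wNorm_nonneg hw0 _ _))

theorem vdmSup_nonneg (k : ℕ) : 0 ≤ vdmSup C K w k :=
  Real.iSup_nonneg fun _ => norm_nonneg _

/-- Upper bound for `V_k` by the product of the smallest norms, for any total order of the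
exponents. -/
theorem vdmSup_le_prod_minNorm (hK : IsCompact K) (hw : ContinuousOn w K)
    (hw0 : ∀ z ∈ K, 0 ≤ w z) (he : Function.Injective e) (k : ℕ) :
    vdmSup C K w k ≤
      (numPts C k).factorial * ∏ a : latticePts C k, minNorm C K w e k a := by
  let S : Set (latticePts C k → ℝ) :=
    Set.univ.pi fun a : latticePts C k => wNorm K w k '' monicFor C e k (a : Fin N →₀ ℕ)
  have hcl : IsClosed {y : latticePts C k → ℝ |
      vdmSup C K w k ≤ (numPts C k).factorial * ∏ a, y a} :=
    isClosed_le continuous_const (continuous_const.mul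
      (continuous_finsetProd _ fun a _ => continuous_apply a))
  have hsub : S ⊆ {y : latticePts C k → ℝ |
      vdmSup C K w k ≤ (numPts C k).factorial * ∏ a, y a} := by
    intro y hy
    choose f hf hfy using fun a => hy a (Set.mem_univ a)
    have := vdmSup_le_prod_wNorm hK hw hw0 he f hf
    simp only [hfy] at this
    exact this
  have hmem : (fun a : latticePts C k => minNorm C K w e k (a : Fin N →₀ ℕ)) ∈ closure S := by
    rw [closure_pi_set]
    exact fun a _ => minNorm_mem_closure hw0 k a
  exact closure_minimal hsub hcl hmem

/-- Lower bound for `V_k` by the product of the smallest norms, for any total order of the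
exponents. -/
theorem prod_minNorm_le_vdmSup (hSigma : unitSimplex N ⊆ (C : Set (Fin N → ℝ)))
    (hK : IsCompact K) (hw : ContinuousOn w K)
    (hw0 : ∀ z ∈ K, 0 ≤ w z) (he : Function.Injective e) (k : ℕ) :
    ∏ a : latticePts C k, minNorm C K w e k a ≤ vdmSup C K w k := by
  classical
  rcases K.eq_empty_or_nonempty with rfl | hne
  -- on the empty set all norms are suprema of the empty set, hence zero
  · rw [Finset.prod_eq_zero (Finset.mem_univ ⟨0, zero_mem_latticePts hSigma k⟩)]
    · exact vdmSup_nonneg k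
    · refine le_antisymm ?_ (minNorm_nonneg hw0 k _)
      refine (minNorm_le hw0 (monomial_mem_monicFor k _)).trans ?_
      exact wNorm_le _ _ le_rfl (by simp)
  have : Nonempty K := hne.to_subtype
  obtain ⟨o, ho⟩ := exists_equiv_fin_of_key (f := fun a : latticePts C k => e a)
    (fun a b hab => Subtype.ext (he hab)) (n := numPts C k) rfl
  obtain ⟨ζ, hζ⟩ := exists_prod_le_norm_det (X := K) (numPts C k)
    (fun i z => ((w z ^ k : ℝ) : ℂ) * ∏ j, (z : Fin N → ℂ) j ^ (o i : Fin N →₀ ℕ) j)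
    (fun i => minNorm C K w e k (o i : Fin N →₀ ℕ)) (fun i => minNorm_nonneg hw0 k _) (by
      intro i c hi hc
      let p : MvPolynomial (Fin N) ℂ := ∑ j, MvPolynomial.monomial (o j : Fin N →₀ ℕ) (c j)
      have hcoeff : ∀ j, p.coeff (o j : Fin N →₀ ℕ) = c j := by
        intro j
        simp only [p, MvPolynomial.coeff_sum, MvPolynomial.coeff_monomial]
        rw [Finset.sum_eq_single j]
        · simp
        · intro b _ hb
          rw [if_neg]
          intro h
          exact hb (o.injective (Subtype.ext h))
        · simp
      have hsupp : ∀ β ∈ p.support, ∃ j, β = (o j : Fin N →₀ ℕ) := by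
        intro β hβ
        have := MvPolynomial.support_sum hβ
        obtain ⟨j, _, hj⟩ := Finset.mem_biUnion.1 this
        exact ⟨j, Finset.mem_singleton.1 (MvPolynomial.support_monomial_subset hj)⟩
      have hp : p ∈ monicFor C e k (o i : Fin N →₀ ℕ) := by
        refine ⟨by rw [hcoeff, hi], fun β hβ hne => ?_⟩
        obtain ⟨j, rfl⟩ := hsupp β hβ
        refine ⟨(o j).2, ?_⟩
        have hji : j ≤ i := by
          by_contra hlt
          rw [MvPolynomial.mem_support_iff, hcoeff, hc j (not_le.1 hlt)] at hβ
          exact hβ rfl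
        have hlt : j < i := lt_of_le_of_ne hji (fun h => hne (by rw [h]))
        exact ho j i hlt
      obtain ⟨z, hz⟩ := exists_wNorm_eq hK hne hw k p
      refine ⟨z, (minNorm_le hw0 hp).trans_eq ?_⟩
      have hev : ∑ j, c j * (((w z ^ k : ℝ) : ℂ) *
          ∏ l, (z : Fin N → ℂ) l ^ (o j : Fin N →₀ ℕ) l) =
          ((w z ^ k : ℝ) : ℂ) * MvPolynomial.eval (z : Fin N → ℂ) p := by
        simp only [p, map_sum, MvPolynomial.eval_monomial, Finset.mul_sum]
        refine Finset.sum_congr rfl fun j _ => ?_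
        rw [Finsupp.prod_fintype _ _ (by simp)]
        ring
      rw [hz, hev, norm_mul, Complex.norm_real,
        Real.norm_of_nonneg (pow_nonneg (hw0 z z.2) k)])
  have hprod : ∏ a : latticePts C k, minNorm C K w e k a =
      ∏ i, minNorm C K w e k (o i : Fin N →₀ ℕ) :=
    (Equiv.prod_comp o fun a : latticePts C k => minNorm C K w e k a).symm
  rw [hprod]
  refine hζ.trans ?_
  have hdet : ‖(Matrix.of fun i j => ((w (ζ j) ^ k : ℝ) : ℂ) *
      ∏ l, (ζ j : Fin N → ℂ) l ^ (o i : Fin N →₀ ℕ) l).det‖ =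
      ‖vdm C w k (fun a => (ζ (o.symm a) : Fin N → ℂ))‖ := by
    rw [vdm, ← Matrix.det_submatrix_equiv_self o]
    congr 2
    ext i j
    simp
  rw [hdet]
  refine le_ciSup (f := fun ζ : latticePts C k → K =>
    ‖vdm C w k (fun a => (ζ a : Fin N → ℂ))‖) ?_ (fun a => ζ (o.symm a))
  refine ⟨(numPts C k).factorial *
    ∏ a : latticePts C k, wNorm K w k (MvPolynomial.monomial (a : Fin N →₀ ℕ) 1), ?_⟩
  rintro _ ⟨η, rfl⟩
  exact norm_vdm_le hK hw hw0 he (fun a => MvPolynomial.monomial (a : Fin N →₀ ℕ) 1)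
    (fun a => monomial_mem_monicFor k _) η

end Det

/-! ### The order `≺_C` and orders compatible with addition -/

section Orders

variable {C : ConvexBody (Fin N → ℝ)}

/-- The order `≺_C`, encoded by a key in a lexicographic product: `r(α)`, then the total degree,
then the exponents themselves. -/
noncomputable def keyC (C : ConvexBody (Fin N → ℝ)) (α : Fin N →₀ ℕ) :
    ℝ ×ₗ ℕ ×ₗ Lex (Fin N →₀ ℕ) :=
  toLex (rC C α, toLex (∑ i, α i, toLex α))

theorem keyC_lt_iff {α β : Fin N →₀ ℕ} : keyC C α < keyC C β ↔ ordCLT C α β := by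
  simp only [keyC, ordCLT, grevlexLT, Prod.Lex.toLex_lt_toLex, Finsupp.Lex.lt_iff, ofLex_toLex]
  simp only [and_comm]

theorem keyC_injective : Function.Injective (keyC C) := by
  intro α β h
  have := congrArg (fun x => (ofLex (ofLex x).2).2) h
  simpa [keyC] using this

theorem monicFor_keyC (k : ℕ) (α : Fin N →₀ ℕ) : monicFor C (keyC C) k α = monicC C k α := by
  ext p
  simp only [monicFor, monicC, keyC_lt_iff]

/-- The constants `T_k^C(α)` in terms of the smallest norms for the key of `≺_C`. -/
theorem chebC_eq (K : Set (Fin N → ℂ)) (w : (Fin N → ℂ) → ℝ) (k : ℕ) (α : Fin N →₀ ℕ) :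
    chebC C K w k α = minNorm C K w (keyC C) k α ^ ((1 : ℝ) / k) := by
  rw [chebC, minNorm, monicFor_keyC]

/-- The additive order of exponents that compares the values of a linear functional first and
breaks ties lexicographically. -/
def linKey (f : (Fin N → ℝ) →ₗ[ℝ] ℝ) (α : Fin N →₀ ℕ) : ℝ ×ₗ Lex (Fin N →₀ ℕ) :=
  toLex (f (expPt α), toLex α)

theorem linKey_injective (f : (Fin N → ℝ) →ₗ[ℝ] ℝ) : Function.Injective (linKey f) := by
  intro α β h
  have := congrArg (fun x => (ofLex x).2) h
  simpa [linKey] using this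

theorem linKey_add_lt (f : (Fin N → ℝ) →ₗ[ℝ] ℝ) (a b c : Fin N →₀ ℕ)
    (h : linKey f a < linKey f b) : linKey f (a + c) < linKey f (b + c) := by
  have hadd : ∀ x y, linKey f (x + y) = linKey f x + linKey f y := by
    intro x y
    simp [linKey, expPt_add, ← toLex_add]
  rw [hadd, hadd]
  exact add_lt_add_left h _

theorem rC_le {α : Fin N →₀ ℕ} {r : ℝ} (hr : 0 ≤ r)
    (h : expPt α ∈ r • (C : Set (Fin N → ℝ))) : rC C α ≤ r :=
  csInf_le ⟨0, fun _ hx => hx.1⟩ ⟨hr, h⟩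

theorem exists_lt_rC_add (hSigma : unitSimplex N ⊆ (C : Set (Fin N → ℝ))) (α : Fin N →₀ ℕ)
    {ε : ℝ} (hε : 0 < ε) :
    ∃ s, 0 ≤ s ∧ s < rC C α + ε ∧ expPt α ∈ s • (C : Set (Fin N → ℝ)) := by
  have hne : {r : ℝ | 0 ≤ r ∧ expPt α ∈ r • (C : Set (Fin N → ℝ))}.Nonempty :=
    ⟨((∑ i, α i : ℕ) : ℝ), Nat.cast_nonneg _, mem_latticePts_of_sum_le hSigma le_rfl⟩
  obtain ⟨s, hs, hlt⟩ := exists_lt_of_csInf_lt hne (lt_add_of_pos_right (rC C α) hε)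
  exact ⟨s, hs.1, hlt, hs.2⟩

theorem sum_smul_mem {ι : Type*} (S : Finset ι) (t s : ι → ℝ) (x : ι → Fin N → ℝ)
    (ht : ∀ b ∈ S, 0 ≤ t b) (hs : ∀ b ∈ S, 0 ≤ s b)
    (hx : ∀ b ∈ S, x b ∈ s b • (C : Set (Fin N → ℝ))) :
    ∑ b ∈ S, t b • x b ∈ (∑ b ∈ S, t b * s b) • (C : Set (Fin N → ℝ)) := by
  classical
  induction S using Finset.induction_on with
  | empty =>
    obtain ⟨c, hc⟩ := C.nonempty
    exact ⟨c, hc, by simp⟩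
  | insert a S ha ih =>
    rw [Finset.sum_insert ha, Finset.sum_insert ha, C.convex.add_smul
      (mul_nonneg (ht a (Finset.mem_insert_self a S)) (hs a (Finset.mem_insert_self a S)))
      (Finset.sum_nonneg fun b hb => mul_nonneg (ht b (Finset.mem_insert_of_mem hb))
        (hs b (Finset.mem_insert_of_mem hb))), mul_smul]
    exact Set.add_mem_add (Set.smul_mem_smul_set (hx a (Finset.mem_insert_self a S)))
      (ih (fun b hb => ht b (Finset.mem_insert_of_mem hb))
        (fun b hb => hs b (Finset.mem_insert_of_mem hb))
        (fun b hb => hx b (Finset.mem_insert_of_mem hb)))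

/-- `r` is convex, in the form of Jensen's inequality. Points of `sC` with `s` slightly larger
than `r` suffice, so that it does not matter whether the infimum is attained. -/
theorem rC_le_sum (hSigma : unitSimplex N ⊆ (C : Set (Fin N → ℝ))) {α : Fin N →₀ ℕ}
    {S : Finset (Fin N →₀ ℕ)} {t : (Fin N →₀ ℕ) → ℝ} (ht : ∀ b ∈ S, 0 ≤ t b)
    (h1 : ∑ b ∈ S, t b = 1) (hα : expPt α = ∑ b ∈ S, t b • expPt b) :
    rC C α ≤ ∑ b ∈ S, t b * rC C b := by
  refine le_of_forall_pos_le_add fun ε hε => ?_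
  choose s hs0 hs1 hs2 using fun b => exists_lt_rC_add hSigma b hε
  have hmem := sum_smul_mem S t s expPt ht (fun b _ => hs0 b) (fun b _ => hs2 b)
  rw [← hα] at hmem
  refine (rC_le (Finset.sum_nonneg fun b hb => mul_nonneg (ht b hb) (hs0 b)) hmem).trans ?_
  calc ∑ b ∈ S, t b * s b ≤ ∑ b ∈ S, (t b * rC C b + t b * ε) := by
        refine Finset.sum_le_sum fun b hb => ?_
        rw [← mul_add]
        exact mul_le_mul_of_nonneg_left (hs1 b).le (ht b hb)
    _ = ∑ b ∈ S, t b * rC C b + ε := by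
        rw [Finset.sum_add_distrib, ← Finset.sum_mul, h1, one_mul]

/-- If a weighted average of numbers `≤ a` is at least `a`, then those with positive weight are
equal to `a`. -/
theorem eq_of_le_weighted_sum {ι : Type*} {S : Finset ι} {t x : ι → ℝ} {a : ℝ}
    (ht : ∀ b ∈ S, 0 ≤ t b) (h1 : ∑ b ∈ S, t b = 1) (hx : ∀ b ∈ S, 0 < t b → x b ≤ a)
    (ha : a ≤ ∑ b ∈ S, t b * x b) : ∀ b ∈ S, 0 < t b → x b = a := by
  have hnn : ∀ b ∈ S, 0 ≤ t b * (a - x b) := by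
    intro b hb
    rcases (ht b hb).eq_or_lt with h | h
    · rw [← h, zero_mul]
    · exact mul_nonneg h.le (sub_nonneg.2 (hx b hb h))
  have hsum : ∑ b ∈ S, t b * (a - x b) ≤ 0 := by
    simp only [mul_sub, Finset.sum_sub_distrib, ← Finset.sum_mul, h1]
    linarith
  have hz := (Finset.sum_eq_zero_iff_of_nonneg hnn).1
    (le_antisymm hsum (Finset.sum_nonneg hnn))
  intro b hb hpos
  have := (mul_eq_zero.1 (hz b hb)).resolve_left hpos.ne'
  linarith

/-- A `≺_C`-maximal element of a finite set of exponents is a vertex of its convex hull. -/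
theorem expPt_notMem_convexHull (hSigma : unitSimplex N ⊆ (C : Set (Fin N → ℝ)))
    {α : Fin N →₀ ℕ} {S : Finset (Fin N →₀ ℕ)} (hS : ∀ b ∈ S, ordCLT C b α) :
    expPt α ∉ convexHull ℝ (expPt '' (S : Set (Fin N →₀ ℕ))) := by
  classical
  intro hmem
  rw [← Finset.coe_image, Finset.mem_convexHull'] at hmem
  obtain ⟨t', ht', h1', hα'⟩ := hmem
  rw [Finset.sum_image expPt_injective.injOn] at h1' hα'
  set t : (Fin N →₀ ℕ) → ℝ := fun b => t' (expPt b) with htdef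
  have ht : ∀ b ∈ S, 0 ≤ t b := fun b hb => ht' _ (Finset.mem_image_of_mem _ hb)
  have hα : expPt α = ∑ b ∈ S, t b • expPt b := hα'.symm
  have hcoord : ∀ i, (α i : ℝ) = ∑ b ∈ S, t b * (b i : ℝ) := by
    intro i
    have := congrFun hα i
    simpa [expPt] using this
  -- the exponents with positive weight agree with `α` in `r`, then in the degree, and then in
  -- each coordinate
  have hr := eq_of_le_weighted_sum ht h1' (fun b hb _ => (hS b hb).elim le_of_lt fun h => h.1.le)
    (rC_le_sum hSigma ht h1' hα)
  have hg : ∀ b ∈ S, 0 < t b → grevlexLT b α := by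
    intro b hb hpos
    rcases hS b hb with h | h
    · exact absurd (hr b hb hpos) h.ne
    · exact h.2
  have hdeg := eq_of_le_weighted_sum (x := fun b => ((∑ i, b i : ℕ) : ℝ))
    (a := ((∑ i, α i : ℕ) : ℝ)) ht h1'
    (fun b hb hpos => by
      rcases hg b hb hpos with h | h
      · exact_mod_cast h.le
      · exact_mod_cast h.1.le)
    (by
      push_cast
      simp only [Finset.mul_sum]
      rw [Finset.sum_comm]
      exact (Finset.sum_congr rfl fun i _ => hcoord i).le)
  have hlex : ∀ b ∈ S, 0 < t b → ∃ i, b i < α i ∧ ∀ j, j < i → b j = α j := by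
    intro b hb hpos
    rcases hg b hb hpos with h | h
    · exact absurd (by exact_mod_cast hdeg b hb hpos) h.ne
    · exact h.2
  have heq : ∀ i : Fin N, ∀ b ∈ S, 0 < t b → b i = α i := by
    intro i
    induction i using WellFoundedLT.induction with
    | _ i ih =>
      have := eq_of_le_weighted_sum (x := fun b => (b i : ℝ)) (a := (α i : ℝ)) ht h1'
        (fun b hb hpos => by
          obtain ⟨j, hj, hlt⟩ := hlex b hb hpos
          rcases lt_trichotomy j i with h | rfl | h
          · exact absurd (ih j h b hb hpos) hj.ne
          · exact_mod_cast hj.le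
          · exact_mod_cast (hlt i h).le) (hcoord i).le
      intro b hb hpos
      exact_mod_cast this b hb hpos
  obtain ⟨b, hb, hpos⟩ : ∃ b ∈ S, 0 < t b := by
    by_contra hno
    push Not at hno
    have : ∑ b ∈ S, t b ≤ 0 := Finset.sum_nonpos hno
    linarith
  obtain ⟨i, hi, _⟩ := hlex b hb hpos
  exact absurd (heq i b hb hpos) hi.ne

/-- A polynomial that is monic for `≺_C` is also monic for an order that is compatible with
addition: its leading exponent is a vertex of its Newton polytope. -/
theorem exists_mem_monicFor_linKey (hSigma : unitSimplex N ⊆ (C : Set (Fin N → ℝ)))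
    {k : ℕ} {α : Fin N →₀ ℕ} {p : MvPolynomial (Fin N) ℂ} (hp : p ∈ monicC C k α) :
    ∃ f : (Fin N → ℝ) →ₗ[ℝ] ℝ, p ∈ monicFor C (linKey f) k α := by
  classical
  have hnot := expPt_notMem_convexHull (C := C) hSigma (α := α) (S := p.support.erase α)
    (fun b hb => (hp.2 b (Finset.mem_of_mem_erase hb) (Finset.ne_of_mem_erase hb)).2)
  have hfin : (expPt '' ((p.support.erase α : Finset _) : Set (Fin N →₀ ℕ))).Finite :=
    (Finset.finite_toSet _).image _
  obtain ⟨f, u, hfu, hu⟩ := geometric_hahn_banach_closed_point (convex_convexHull ℝ _)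
    (hfin.isCompact_convexHull ℝ).isClosed hnot
  refine ⟨f, hp.1, fun β hβ hne => ⟨(hp.2 β hβ hne).1, ?_⟩⟩
  have hlt : f (expPt β) < f (expPt α) := (hfu _ (subset_convexHull ℝ _
    ⟨β, Finset.mem_coe.2 (Finset.mem_erase.2 ⟨hne, hβ⟩), rfl⟩)).trans hu
  exact Prod.Lex.toLex_lt_toLex.2 (Or.inl hlt)

end Orders

/-! ### Lattice sums as integrals of step functions -/

section Riemann

variable {C : ConvexBody (Fin N → ℝ)}

/-- The lattice point `⌊kθ⌋`, taken coordinatewise. -/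
noncomputable def floorPt (k : ℕ) (θ : Fin N → ℝ) : Fin N →₀ ℕ :=
  Finsupp.equivFunOnFinite.symm fun i => ⌊θ i * k⌋₊

/-- The cube of side `1/k` with lowest corner `α/k`. -/
def cube (k : ℕ) (α : Fin N →₀ ℕ) : Set (Fin N → ℝ) :=
  Set.univ.pi fun i => Set.Ico ((α i : ℝ) / k) (((α i : ℝ) + 1) / k)

theorem measurableSet_cube (k : ℕ) (α : Fin N →₀ ℕ) : MeasurableSet (cube k α) :=
  MeasurableSet.univ_pi fun _ => measurableSet_Ico

theorem volume_real_cube {k : ℕ} (hk : k ≠ 0) (α : Fin N →₀ ℕ) :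
    volume.real (cube k α) = ((k : ℝ) ^ N)⁻¹ := by
  have hk' : (0 : ℝ) < k := Nat.cast_pos.2 (Nat.pos_of_ne_zero hk)
  rw [measureReal_def, cube, Real.volume_pi_Ico, ENNReal.toReal_prod]
  have : ∀ i : Fin N, (ENNReal.ofReal (((α i : ℝ) + 1) / k - (α i : ℝ) / k)).toReal
      = (k : ℝ)⁻¹ := by
    intro i
    rw [← sub_div, add_sub_cancel_left, one_div, ENNReal.toReal_ofReal (by positivity)]
  simp [this]

theorem mem_cube_iff {k : ℕ} (hk : k ≠ 0) {α : Fin N →₀ ℕ} {θ : Fin N → ℝ} :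
    θ ∈ cube k α ↔ (∀ i, 0 ≤ θ i) ∧ floorPt k θ = α := by
  have hk' : (0 : ℝ) < k := Nat.cast_pos.2 (Nat.pos_of_ne_zero hk)
  simp only [cube, Set.mem_univ_pi, Set.mem_Ico, div_le_iff₀ hk', lt_div_iff₀ hk']
  constructor
  · intro h
    have h0 : ∀ i, 0 ≤ θ i * k := fun i => (Nat.cast_nonneg _).trans (h i).1
    refine ⟨fun i => nonneg_of_mul_nonneg_left (h0 i) hk', ?_⟩
    ext i
    exact (Nat.floor_eq_iff (h0 i)).2 (h i)
  · rintro ⟨h0, rfl⟩ i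
    exact (Nat.floor_eq_iff (mul_nonneg (h0 i) hk'.le)).1 rfl

theorem norm_sub_le_of_mem_cube {k : ℕ} (hk : k ≠ 0) {α : Fin N →₀ ℕ} {θ : Fin N → ℝ}
    (h : θ ∈ cube k α) : ‖(k : ℝ)⁻¹ • expPt α - θ‖ ≤ (k : ℝ)⁻¹ := by
  have hk' : (0 : ℝ) < k := Nat.cast_pos.2 (Nat.pos_of_ne_zero hk)
  rw [pi_norm_le_iff_of_nonneg (by positivity)]
  intro i
  have hi := h i (Set.mem_univ i)
  rw [Set.mem_Ico, add_div] at hi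
  simp only [Pi.sub_apply, Pi.smul_apply, smul_eq_mul, expPt]
  rw [Real.norm_eq_abs, abs_le, inv_mul_eq_div]
  constructor
  · have := hi.2
    rw [one_div] at this
    linarith
  · have : (0 : ℝ) ≤ (k : ℝ)⁻¹ := by positivity
    linarith [hi.1]

theorem tendsto_floorPt {θ : Fin N → ℝ} (hθ : ∀ i, 0 ≤ θ i) :
    Tendsto (fun k : ℕ => (k : ℝ)⁻¹ • expPt (floorPt k θ)) atTop (𝓝 θ) := by
  rw [tendsto_pi_nhds]
  intro i
  have := (tendsto_nat_floor_mul_div_atTop (hθ i)).comp tendsto_natCast_atTop_atTop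
  refine this.congr fun k => ?_
  simp [expPt, floorPt, inv_mul_eq_div]

theorem eventually_floorPt_mem {θ : Fin N → ℝ} (hθ : ∀ i, 0 ≤ θ i)
    (hint : θ ∈ interior (C : Set (Fin N → ℝ))) :
    ∀ᶠ k : ℕ in atTop, floorPt k θ ∈ latticePts C k := by
  have h1 := (tendsto_floorPt hθ).eventually (mem_interior_iff_mem_nhds.1 hint)
  filter_upwards [h1, eventually_ne_atTop 0] with k hk hk0
  exact (mem_latticePts_iff hk0).2 hk

theorem tendsto_dirFilter {θ : Fin N → ℝ} {α : ℕ → Fin N →₀ ℕ}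
    (h : Tendsto (fun k : ℕ => (k : ℝ)⁻¹ • expPt (α k)) atTop (𝓝 θ))
    (hmem : ∀ᶠ k in atTop, α k ∈ latticePts C k) :
    Tendsto (fun k => (k, α k)) atTop (dirFilter C θ) := by
  refine tendsto_inf.2 ⟨tendsto_inf.2 ⟨?_, ?_⟩, ?_⟩
  · exact tendsto_comap_iff.2 tendsto_id
  · exact tendsto_comap_iff.2 h
  · exact tendsto_principal.2 hmem

theorem tendsto_floorPt_dirFilter (hC : ∀ x ∈ C, ∀ i, 0 ≤ x i) {θ : Fin N → ℝ}
    (hint : θ ∈ interior (C : Set (Fin N → ℝ))) :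
    Tendsto (fun k => (k, floorPt k θ)) atTop (dirFilter C θ) :=
  have h0 := hC θ (interior_subset hint)
  tendsto_dirFilter (tendsto_floorPt h0) (eventually_floorPt_mem h0 hint)

/-- The function that is equal to `h α` on the cube of side `1/k` at `α/k`, for the lattice
points `α` of `kC`, and to zero elsewhere. -/
noncomputable def stepFun (C : ConvexBody (Fin N → ℝ)) (k : ℕ) (h : (Fin N →₀ ℕ) → ℝ)
    (θ : Fin N → ℝ) : ℝ :=
  ∑ a : latticePts C k, (cube k (a : Fin N →₀ ℕ)).indicator (fun _ => h a) θ

theorem stepFun_eq {k : ℕ} (hk : k ≠ 0) (h : (Fin N →₀ ℕ) → ℝ) {α : Fin N →₀ ℕ}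
    (hα : α ∈ latticePts C k) {θ : Fin N → ℝ} (hθ : θ ∈ cube k α) :
    stepFun C k h θ = h α := by
  rw [stepFun, Finset.sum_eq_single (⟨α, hα⟩ : latticePts C k)]
  · exact Set.indicator_of_mem hθ _
  · intro b _ hb
    refine Set.indicator_of_notMem (fun hmem => hb (Subtype.ext ?_)) _
    exact ((mem_cube_iff hk).1 hmem).2.symm.trans ((mem_cube_iff hk).1 hθ).2
  · exact fun hno => absurd (Finset.mem_univ _) hno

theorem stepFun_eq_zero {k : ℕ} (h : (Fin N →₀ ℕ) → ℝ) {θ : Fin N → ℝ}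
    (hθ : ∀ α ∈ latticePts C k, θ ∉ cube k α) : stepFun C k h θ = 0 :=
  Finset.sum_eq_zero fun a _ => Set.indicator_of_notMem (hθ a a.2) _

theorem measurable_stepFun (k : ℕ) (h : (Fin N →₀ ℕ) → ℝ) : Measurable (stepFun C k h) :=
  Finset.measurable_fun_sum _ fun _ _ => measurable_const.indicator (measurableSet_cube _ _)

theorem volume_cube_ne_top (k : ℕ) (α : Fin N →₀ ℕ) : volume (cube k α) ≠ ⊤ := by
  rw [cube, Real.volume_pi_Ico]
  exact ENNReal.prod_ne_top fun _ _ => ENNReal.ofReal_ne_top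

theorem integral_stepFun {k : ℕ} (hk : k ≠ 0) (h : (Fin N →₀ ℕ) → ℝ) :
    ∫ θ, stepFun C k h θ = (∑ a : latticePts C k, h a) / (k : ℝ) ^ N := by
  simp only [stepFun]
  rw [integral_finsetSum]
  · rw [Finset.sum_div]
    refine Finset.sum_congr rfl fun a _ => ?_
    rw [integral_indicator_const _ (measurableSet_cube _ _), volume_real_cube hk, smul_eq_mul,
      inv_mul_eq_div]
  · intro a _
    exact (integrable_indicator_iff (measurableSet_cube _ _)).2
      (integrableOn_const (volume_cube_ne_top _ _))

theorem abs_stepFun_le {k : ℕ} (hk : k ≠ 0) {h : (Fin N →₀ ℕ) → ℝ} {B R : ℝ} (hB : 0 ≤ B)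
    (hh : ∀ α ∈ latticePts C k, |h α| ≤ B) (hR : ∀ x ∈ C, ‖x‖ ≤ R) (θ : Fin N → ℝ) :
    ‖stepFun C k h θ‖ ≤ (Metric.closedBall (0 : Fin N → ℝ) (R + 1)).indicator (fun _ => B) θ := by
  by_cases hex : ∃ α ∈ latticePts C k, θ ∈ cube k α
  · obtain ⟨α, hα, hθ⟩ := hex
    rw [stepFun_eq hk h hα hθ, Set.indicator_of_mem]
    · exact hh α hα
    · rw [mem_closedBall_zero_iff]
      have h1 := hR _ ((mem_latticePts_iff hk).1 hα)
      have h2 := norm_sub_le_of_mem_cube hk hθ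
      have h3 : (k : ℝ)⁻¹ ≤ 1 :=
        inv_le_one_of_one_le₀ (by exact_mod_cast Nat.one_le_iff_ne_zero.2 hk)
      have h4 := norm_sub_norm_le θ ((k : ℝ)⁻¹ • expPt α)
      rw [norm_sub_rev] at h4
      linarith
  · push Not at hex
    rw [stepFun_eq_zero h hex, norm_zero]
    exact Set.indicator_nonneg (fun _ _ => hB) θ

theorem eventually_stepFun_eq_zero {h : ℕ → (Fin N →₀ ℕ) → ℝ} {θ : Fin N → ℝ}
    (hθ : θ ∉ C) : ∀ᶠ k : ℕ in atTop, stepFun C k (h k) θ = 0 := by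
  have hopen : (C : Set (Fin N → ℝ))ᶜ ∈ 𝓝 θ := C.isCompact.isClosed.isOpen_compl.mem_nhds hθ
  obtain ⟨ε, hε, hball⟩ := Metric.mem_nhds_iff.1 hopen
  have hlim : Tendsto (fun k : ℕ => (k : ℝ)⁻¹) atTop (𝓝 0) := tendsto_inv_atTop_nhds_zero_nat
  filter_upwards [hlim.eventually (gt_mem_nhds hε), eventually_ne_atTop 0] with k hk hk0
  refine stepFun_eq_zero _ fun α hα hmem => ?_
  refine hball ?_ ((mem_latticePts_iff hk0).1 hα)
  rw [mem_ball_iff_norm]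
  exact (norm_sub_le_of_mem_cube hk0 hmem).trans_lt hk

theorem tendsto_stepFun_interior (hC : ∀ x ∈ C, ∀ i, 0 ≤ x i) {h : ℕ → (Fin N →₀ ℕ) → ℝ}
    {θ : Fin N → ℝ} {t : ℝ} (hint : θ ∈ interior (C : Set (Fin N → ℝ)))
    (ht : Tendsto (fun x : ℕ × (Fin N →₀ ℕ) => h x.1 x.2) (dirFilter C θ) (𝓝 t)) :
    Tendsto (fun k => stepFun C k (h k) θ) atTop (𝓝 t) := by
  have h0 := hC θ (interior_subset hint)
  refine (ht.comp (tendsto_floorPt_dirFilter hC hint)).congr' ?_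
  filter_upwards [eventually_floorPt_mem h0 hint, eventually_ne_atTop 0] with k hk hk0
  exact (stepFun_eq hk0 (h k) hk ((mem_cube_iff hk0).2 ⟨h0, rfl⟩)).symm

/-- Bounded functions of `(k, α)` with directional limits almost everywhere: the normalized sums
over the lattice points of `kC` converge to the integral of the directional limits. -/
theorem tendsto_sum_latticePts_div (hC : ∀ x ∈ C, ∀ i, 0 ≤ x i)
    {h : ℕ → (Fin N →₀ ℕ) → ℝ} {B : ℝ} (hB : 0 ≤ B)
    (hh : ∀ k, k ≠ 0 → ∀ α ∈ latticePts C k, |h k α| ≤ B) {H : (Fin N → ℝ) → ℝ}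
    (hH : ∀ᵐ θ ∂(volume.restrict (interior (C : Set (Fin N → ℝ)))),
      Tendsto (fun x : ℕ × (Fin N →₀ ℕ) => h x.1 x.2) (dirFilter C θ) (𝓝 (H θ))) :
    Tendsto (fun k : ℕ => (∑ a : latticePts C k, h k a) / (k : ℝ) ^ N) atTop
      (𝓝 (∫ θ in interior (C : Set (Fin N → ℝ)), H θ)) := by
  have hmeas : MeasurableSet (interior (C : Set (Fin N → ℝ))) := isOpen_interior.measurableSet
  obtain ⟨R, hR⟩ := C.isCompact.isBounded.exists_norm_le
  rw [← integral_indicator hmeas]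
  have hev : (fun k : ℕ => ∫ θ, stepFun C k (h k) θ) =ᶠ[atTop]
      fun k : ℕ => (∑ a : latticePts C k, h k a) / (k : ℝ) ^ N := by
    filter_upwards [eventually_ne_atTop 0] with k hk using integral_stepFun hk (h k)
  refine Tendsto.congr' hev ?_
  refine tendsto_integral_filter_of_dominated_convergence
    ((Metric.closedBall (0 : Fin N → ℝ) (R + 1)).indicator fun _ => B)
    (Eventually.of_forall fun k => (measurable_stepFun k (h k)).aestronglyMeasurable) ?_ ?_ ?_
  · filter_upwards [eventually_ne_atTop 0] with k hk
    exact Eventually.of_forall fun θ => abs_stepFun_le hk hB (hh k hk) hR θ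
  · exact (integrable_indicator_iff measurableSet_closedBall).2
      (integrableOn_const measure_closedBall_lt_top.ne)
  · have hfr : ∀ᵐ θ ∂(volume : Measure (Fin N → ℝ)), θ ∉ frontier (C : Set (Fin N → ℝ)) :=
      measure_eq_zero_iff_ae_notMem.1 (C.convex.addHaar_frontier volume)
    filter_upwards [hfr, (ae_restrict_iff' hmeas).1 hH] with θ hθ hlim
    by_cases hint : θ ∈ interior (C : Set (Fin N → ℝ))
    · rw [Set.indicator_of_mem hint]
      exact tendsto_stepFun_interior hC hint (hlim hint)
    · rw [Set.indicator_of_notMem hint]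
      have hnot : θ ∉ C := fun hmem => hθ ⟨subset_closure hmem, hint⟩
      exact tendsto_const_nhds.congr'
        ((eventually_stepFun_eq_zero hnot).mono fun k hk => hk.symm)

theorem aemeasurable_of_dirLimit (hC : ∀ x ∈ C, ∀ i, 0 ≤ x i)
    {h : ℕ → (Fin N →₀ ℕ) → ℝ} {H : (Fin N → ℝ) → ℝ}
    (hH : ∀ᵐ θ ∂(volume.restrict (interior (C : Set (Fin N → ℝ)))),
      Tendsto (fun x : ℕ × (Fin N →₀ ℕ) => h x.1 x.2) (dirFilter C θ) (𝓝 (H θ))) :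
    AEMeasurable H (volume.restrict (interior (C : Set (Fin N → ℝ)))) := by
  refine aemeasurable_of_tendsto_metrizable_ae atTop
    (fun k => (measurable_stepFun (C := C) k (h k)).aemeasurable) ?_
  filter_upwards [hH, ae_restrict_mem isOpen_interior.measurableSet] with θ hlim hint
  exact tendsto_stepFun_interior hC hint hlim

theorem volume_interior (C : ConvexBody (Fin N → ℝ)) :
    volume (interior (C : Set (Fin N → ℝ))) = volume (C : Set (Fin N → ℝ)) := by
  refine le_antisymm (measure_mono interior_subset) ?_
  have hsub : (C : Set (Fin N → ℝ)) ⊆ interior (C : Set (Fin N → ℝ)) ∪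
      frontier (C : Set (Fin N → ℝ)) := by
    rw [← closure_eq_interior_union_frontier]
    exact subset_closure
  refine (measure_mono hsub).trans ((measure_union_le _ _).trans_eq ?_)
  rw [C.convex.addHaar_frontier volume, add_zero]

theorem interior_nonempty (hSigma : unitSimplex N ⊆ (C : Set (Fin N → ℝ))) :
    (interior (C : Set (Fin N → ℝ))).Nonempty := by
  have hN : (0 : ℝ) < (N : ℝ) + 1 := by positivity
  refine ⟨fun _ => ((N : ℝ) + 1)⁻¹, interior_mono hSigma ?_⟩
  have hopen : IsOpen {x : Fin N → ℝ | (∀ i, 0 < x i) ∧ ∑ i, x i < 1} := by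
    have h1 : IsOpen {x : Fin N → ℝ | ∀ i, 0 < x i} := by
      simp only [Set.ofPred_forall]
      exact isOpen_iInter_of_finite fun i => isOpen_lt continuous_const (continuous_apply i)
    exact h1.inter (isOpen_lt (continuous_finsetSum _ fun i _ => continuous_apply i)
      continuous_const)
  refine mem_interior.2 ⟨_, fun x hx => ⟨fun i => (hx.1 i).le, hx.2.le⟩, hopen,
    fun i => by positivity, ?_⟩
  simp only [Finset.sum_const, Finset.card_univ, Fintype.card_fin, nsmul_eq_mul]
  rw [← div_eq_mul_inv, div_lt_one hN]
  linarith

theorem volume_toReal_pos (hSigma : unitSimplex N ⊆ (C : Set (Fin N → ℝ))) :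
    0 < (volume (C : Set (Fin N → ℝ))).toReal := by
  refine ENNReal.toReal_pos ?_ C.isCompact.measure_lt_top.ne
  rw [← volume_interior]
  exact (isOpen_interior.measure_pos volume (interior_nonempty hSigma)).ne'

/-- The number of lattice points of `kC` is asymptotic to `vol(C) k^N`. -/
theorem tendsto_numPts_div (hC : ∀ x ∈ C, ∀ i, 0 ≤ x i) :
    Tendsto (fun k : ℕ => (numPts C k : ℝ) / (k : ℝ) ^ N) atTop
      (𝓝 (volume (C : Set (Fin N → ℝ))).toReal) := by
  have := tendsto_sum_latticePts_div hC (h := fun _ _ => 1) (B := 1) zero_le_one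
    (fun _ _ _ _ => by simp) (H := fun _ => 1) (Eventually.of_forall fun _ => tendsto_const_nhds)
  simpa [numPts, volume_interior, measureReal_def] using this

end Riemann

/-! ### Existence of the limit of the Vandermonde determinants -/

section Limit

/-- A multiplicative Fekete lemma: if `a k ≤ a m ^ (⌊k / (m + N)⌋ ^ (N + 1))` for all `k` and `m`,
then the roots of order `k ^ (N + 1)` of `a k` converge. -/
theorem exists_tendsto_rpow_of_le_pow (N : ℕ) {a : ℕ → ℝ} (h0 : ∀ k, 0 ≤ a k)
    (h1 : ∀ k, a k ≤ 1)
    (h : ∀ m k, m ≠ 0 → a k ≤ a m ^ ((k / (m + N)) ^ (N + 1))) :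
    ∃ L, Tendsto (fun k : ℕ => a k ^ ((1 : ℝ) / (k : ℝ) ^ (N + 1))) atTop (𝓝 L) := by
  set b : ℕ → ℝ := fun k => a k ^ ((1 : ℝ) / (k : ℝ) ^ (N + 1)) with hb
  have hb0 : ∀ k, 0 ≤ b k := fun k => Real.rpow_nonneg (h0 k) _
  have hb1 : ∀ k, b k ≤ 1 := fun k => Real.rpow_le_one (h0 k) (h1 k) (by positivity)
  -- the exponent with which `b m` bounds `b k` in the limit `k → ∞`
  set c : ℕ → ℝ := fun m => ((m : ℝ) / ((m : ℝ) + N)) ^ (N + 1) with hc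
  have hbound : ∀ m k, m ≠ 0 → k ≠ 0 → b k ≤
      b m ^ (((m : ℝ) * (((k / (m + N) : ℕ) : ℝ) / k)) ^ (N + 1)) := by
    intro m k hm hk
    have hm' : (0 : ℝ) < m := Nat.cast_pos.2 (Nat.pos_of_ne_zero hm)
    have hk' : (0 : ℝ) < k := Nat.cast_pos.2 (Nat.pos_of_ne_zero hk)
    have h2 := Real.rpow_le_rpow (h0 k) (h m k hm)
      (by positivity : 0 ≤ (1 : ℝ) / (k : ℝ) ^ (N + 1))
    refine h2.trans_eq ?_
    rw [hb]
    simp only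
    rw [← Real.rpow_natCast, ← Real.rpow_mul (h0 m), ← Real.rpow_mul (h0 m)]
    congr 1
    push_cast
    rw [mul_pow, div_pow]
    field_simp
  have hlim : ∀ m, m ≠ 0 → Tendsto (fun k : ℕ =>
      b m ^ (((m : ℝ) * (((k / (m + N) : ℕ) : ℝ) / k)) ^ (N + 1))) atTop (𝓝 (b m ^ c m)) := by
    intro m hm
    have hm' : (0 : ℝ) < m := Nat.cast_pos.2 (Nat.pos_of_ne_zero hm)
    have h3 : Tendsto (fun k : ℕ => ((k / (m + N) : ℕ) : ℝ) / k) atTop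
        (𝓝 (((m : ℝ) + N)⁻¹)) := by
      have := (tendsto_nat_floor_mul_div_atTop (R := ℝ) (a := ((m : ℝ) + N)⁻¹)
        (by positivity)).comp tendsto_natCast_atTop_atTop
      refine this.congr fun k => ?_
      simp only [Function.comp]
      rw [inv_mul_eq_div, ← Nat.cast_add, Nat.floor_div_eq_div]
    refine tendsto_const_nhds.rpow ((h3.const_mul (m : ℝ)).pow (N + 1)) (Or.inr ?_)
    positivity
  have hc1 : Tendsto c atTop (𝓝 1) := by
    have : Tendsto (fun m : ℕ => (m : ℝ) / ((m : ℝ) + N)) atTop (𝓝 1) :=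
      tendsto_natCast_div_add_atTop (N : ℝ)
    simpa [hc] using this.pow (N + 1)
  have hcpos : ∀ m, 0 ≤ c m := fun m => by positivity
  refine tendsto_of_no_upcrossings dense_univ ?_
    (isBoundedUnder_of ⟨1, hb1⟩) (isBoundedUnder_of ⟨0, hb0⟩)
  rintro x - y - hxy ⟨hfx, hfy⟩
  have hx : 0 < x := by
    obtain ⟨m, hm⟩ := hfx.exists
    exact (hb0 m).trans_lt hm
  have hpow : Tendsto (fun m => x ^ c m) atTop (𝓝 x) := by
    have : Tendsto (fun m => x ^ c m) atTop (𝓝 (x ^ (1 : ℝ))) :=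
      tendsto_const_nhds.rpow hc1 (Or.inl hx.ne')
    rwa [Real.rpow_one] at this
  obtain ⟨m, hmx, hmy, hm0⟩ := (hfx.and_eventually
    ((hpow.eventually (gt_mem_nhds hxy)).and (eventually_ne_atTop 0))).exists
  have hlt : b m ^ c m < y := (Real.rpow_le_rpow (hb0 m) hmx.le (hcpos m)).trans_lt hmy
  have hev : ∀ᶠ k in atTop, b k < y := by
    filter_upwards [(hlim m hm0).eventually (gt_mem_nhds hlt), eventually_ne_atTop 0] with k hk hk0
    exact (hbound m k hm0 hk0).trans_lt hk
  obtain ⟨k, hk, hk'⟩ := (hfy.and_eventually hev).exists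
  exact absurd hk (not_lt.2 hk'.le)

theorem prod_le_prod_comp_of_injective {ι κ : Type*} [Fintype ι] [Fintype κ] {φ : κ → ι}
    (hφ : Function.Injective φ) {g : ι → ℝ} (h0 : ∀ i, 0 ≤ g i) (h1 : ∀ i, g i ≤ 1) :
    ∏ i, g i ≤ ∏ j, g (φ j) := by
  classical
  rw [← Finset.prod_image (s := Finset.univ) (g := φ) (f := g) hφ.injOn,
    ← Finset.prod_sdiff (Finset.subset_univ (Finset.univ.image φ))]
  exact mul_le_of_le_one_left (Finset.prod_nonneg fun i _ => h0 i)
    (Finset.prod_le_one (fun i _ => h0 i) fun i _ => h1 i)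

variable {C : ConvexBody (Fin N → ℝ)} {K : Set (Fin N → ℂ)} {w : (Fin N → ℂ) → ℝ}
  {G : Type*} [LinearOrder G] {e : (Fin N →₀ ℕ) → G}

/-- For an order compatible with addition, `z^δ p^q` is a competitor for the exponent `qγ + δ`. -/
theorem minNorm_le_pow_mul (hK : IsCompact K) (hw : ContinuousOn w K)
    (hw0 : ∀ z ∈ K, 0 ≤ w z) (hadd : ∀ a b c, e a < e b → e (a + c) < e (b + c)) {A : ℝ}
    (hA : ∀ k : ℕ, ∀ α ∈ latticePts C k, wNorm K w k (MvPolynomial.monomial α 1) ≤ A ^ k)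
    {m l : ℕ} {γ δ : Fin N →₀ ℕ} (hγ : γ ∈ latticePts C m) (hδ : δ ∈ latticePts C l) (q : ℕ) :
    minNorm C K w e (q * m + l) (q • γ + δ) ≤ minNorm C K w e m γ ^ q * A ^ l := by
  refine le_of_forall_monicFor hw0 (g := fun y => y ^ q * A ^ l) (by fun_prop) fun p hp => ?_
  refine (minNorm_le hw0 (mul_mem_monicFor hadd (nsmul_mem_latticePts q hγ) hδ
    (pow_mem_monicFor hadd hγ hp q) (monomial_mem_monicFor l δ))).trans ?_
  refine (wNorm_mul_le hK hw hw0 _ _ _ _).trans ?_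
  exact mul_le_mul (wNorm_pow_le hK hw hw0 m p q) (hA l δ hδ) (wNorm_nonneg hw0 _ _)
    (pow_nonneg (wNorm_nonneg hw0 _ _) _)

/-- The translates of `q • (mC)` by the points of a box of side `q` embed `q ^ N` copies of the
lattice points of `mC` into `kC`, where `q = ⌊k / (m + N)⌋`. -/
theorem prod_minNorm_div_le_pow (hSigma : unitSimplex N ⊆ (C : Set (Fin N → ℝ)))
    (hK : IsCompact K) (hw : ContinuousOn w K)
    (hw0 : ∀ z ∈ K, 0 ≤ w z) (hadd : ∀ a b c, e a < e b → e (a + c) < e (b + c)) {A : ℝ}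
    (hA1 : 1 ≤ A)
    (hA : ∀ k : ℕ, ∀ α ∈ latticePts C k, wNorm K w k (MvPolynomial.monomial α 1) ≤ A ^ k)
    (m k : ℕ) :
    ∏ a : latticePts C k, minNorm C K w e k a / A ^ k ≤
      (∏ a : latticePts C m, minNorm C K w e m a / A ^ m) ^ ((k / (m + N)) ^ (N + 1)) := by
  have hA0 : 0 < A := one_pos.trans_le hA1
  set q := k / (m + N) with hq
  have hqk : q * (m + N) ≤ k := Nat.div_mul_le_self k (m + N)
  have hk : q * m + (k - q * m) = k := Nat.add_sub_of_le (by nlinarith)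
  let pt : (Fin N → Fin q) → Fin N →₀ ℕ := fun δ =>
    Finsupp.equivFunOnFinite.symm fun i => (δ i : ℕ)
  have hpt : ∀ δ i, pt δ i = (δ i : ℕ) := fun δ i => rfl
  have hδ : ∀ δ, pt δ ∈ latticePts C (k - q * m) := by
    intro δ
    refine mem_latticePts_of_sum_le hSigma ?_
    have : ∑ i, pt δ i ≤ ∑ _i : Fin N, q := Finset.sum_le_sum fun i _ => (δ i).2.le
    rw [Finset.sum_const, Finset.card_univ, Fintype.card_fin, smul_eq_mul] at this
    refine this.trans (Nat.le_sub_of_add_le ?_)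
    linarith [mul_add q m N, mul_comm N q]
  let φ : latticePts C m × (Fin N → Fin q) → latticePts C k := fun x =>
    ⟨q • (x.1 : Fin N →₀ ℕ) + pt x.2, by
      have := add_mem_latticePts (nsmul_mem_latticePts q x.1.2) (hδ x.2)
      rwa [hk] at this⟩
  have hφ : Function.Injective φ := by
    rintro ⟨γ, δ⟩ ⟨γ', δ'⟩ heq
    have hi : ∀ i, q * (γ : Fin N →₀ ℕ) i + (δ i : ℕ) = q * (γ' : Fin N →₀ ℕ) i + (δ' i : ℕ) := by
      intro i
      have := DFunLike.congr_fun (congrArg Subtype.val heq) i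
      simpa [φ, hpt] using this
    -- `δ` is the remainder of `qγ + δ` modulo `q` in each coordinate
    have hmod : ∀ i, (δ i : ℕ) = δ' i := by
      intro i
      have := congrArg (· % q) (hi i)
      simpa [Nat.mul_add_mod, Nat.mod_eq_of_lt (δ i).2, Nat.mod_eq_of_lt (δ' i).2] using this
    have hγ : γ = γ' := by
      refine Subtype.ext (Finsupp.ext fun i => ?_)
      have h1 := hi i
      rw [hmod i] at h1
      exact Nat.eq_of_mul_eq_mul_left (Nat.pos_of_ne_zero fun h0 => by
        have := (δ i).2; omega) (Nat.add_right_cancel h1)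
    exact Prod.ext hγ (funext fun i => Fin.ext (hmod i))
  have hτ0 : ∀ l (a : latticePts C l), 0 ≤ minNorm C K w e l a / A ^ l := fun l a =>
    div_nonneg (minNorm_nonneg hw0 _ _) (by positivity)
  have hτ1 : ∀ l (a : latticePts C l), minNorm C K w e l a / A ^ l ≤ 1 := fun l a =>
    div_le_one_of_le₀ (minNorm_le_pow hw0 hA a.2) (by positivity)
  refine (prod_le_prod_comp_of_injective hφ (hτ0 k) (hτ1 k)).trans ?_
  have hterm : ∀ x : latticePts C m × (Fin N → Fin q),
      minNorm C K w e k (φ x : Fin N →₀ ℕ) / A ^ k ≤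
        (minNorm C K w e m (x.1 : Fin N →₀ ℕ) / A ^ m) ^ q := by
    intro x
    have := minNorm_le_pow_mul hK hw hw0 hadd hA x.1.2 (hδ x.2) q
    rw [hk] at this
    rw [div_le_iff₀ (by positivity), div_pow]
    refine this.trans_eq ?_
    have hpow : (A ^ m) ^ q * A ^ (k - q * m) = A ^ k := by
      rw [← pow_mul, mul_comm m q, ← pow_add, hk]
    rw [← hpow, ← mul_assoc, div_mul_cancel₀ _ (by positivity)]
  refine (Finset.prod_le_prod (fun x _ => hτ0 k (φ x)) fun x _ => hterm x).trans_eq ?_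
  rw [Fintype.prod_prod_type]
  simp only [Finset.prod_const, Finset.card_univ, Fintype.card_fun, Fintype.card_fin, ← pow_mul]
  rw [Finset.prod_pow, pow_succ, mul_comm q]

theorem tendsto_numPts_rpow (hC : ∀ x ∈ C, ∀ i, 0 ≤ x i)
    (hSigma : unitSimplex N ⊆ (C : Set (Fin N → ℝ))) :
    Tendsto (fun k : ℕ => (numPts C k : ℝ) ^ ((1 : ℝ) / k)) atTop (𝓝 1) := by
  have h1 : Tendsto (fun k : ℕ => ((numPts C k : ℝ) / (k : ℝ) ^ N) ^ ((1 : ℝ) / k)) atTop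
      (𝓝 ((volume (C : Set (Fin N → ℝ))).toReal ^ (0 : ℝ))) :=
    (tendsto_numPts_div hC).rpow tendsto_one_div_atTop_nhds_zero_nat
      (Or.inl (volume_toReal_pos hSigma).ne')
  have h2 : Tendsto (fun k : ℕ => ((k : ℝ) ^ ((1 : ℝ) / k)) ^ N) atTop (𝓝 (1 ^ N)) :=
    (tendsto_rpow_div.comp tendsto_natCast_atTop_atTop).pow N
  have h3 := h1.mul h2
  rw [Real.rpow_zero, one_pow, one_mul] at h3
  refine h3.congr' ?_
  filter_upwards [eventually_ne_atTop 0] with k hk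
  have hk' : (0 : ℝ) < k := Nat.cast_pos.2 (Nat.pos_of_ne_zero hk)
  rw [← Real.rpow_natCast ((k : ℝ) ^ ((1 : ℝ) / k)), ← Real.rpow_mul hk'.le, mul_comm (1 / (k : ℝ)),
    Real.rpow_mul hk'.le, Real.rpow_natCast, ← Real.mul_rpow (by positivity) (by positivity)]
  congr 1
  field_simp

theorem tendsto_factorial_numPts_rpow (hC : ∀ x ∈ C, ∀ i, 0 ≤ x i)
    (hSigma : unitSimplex N ⊆ (C : Set (Fin N → ℝ))) :
    Tendsto (fun k : ℕ => ((numPts C k).factorial : ℝ) ^ ((1 : ℝ) / (k * numPts C k))) atTop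
      (𝓝 1) := by
  refine tendsto_of_tendsto_of_tendsto_of_le_of_le tendsto_const_nhds
    (tendsto_numPts_rpow hC hSigma) (fun k => ?_) (fun k => ?_)
  · exact Real.one_le_rpow (by exact_mod_cast Nat.one_le_iff_ne_zero.2 (Nat.factorial_ne_zero _))
      (by positivity)
  · have hM : (0 : ℝ) < numPts C k := Nat.cast_pos.2 (numPts_pos hSigma k)
    have h1 : ((numPts C k).factorial : ℝ) ≤ (numPts C k : ℝ) ^ (numPts C k) := by
      exact_mod_cast Nat.factorial_le_pow _
    refine (Real.rpow_le_rpow (by positivity) h1 (by positivity)).trans_eq ?_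
    rw [← Real.rpow_natCast, ← Real.rpow_mul hM.le]
    congr 1
    rw [mul_one_div, mul_comm (k : ℝ), ← div_div, div_self hM.ne']

/-- A quantity that approximates the Vandermonde determinants up to the factor `M_k!` has the same
normalized roots in the limit. -/
theorem tendsto_vdmSup_rpow (hC : ∀ x ∈ C, ∀ i, 0 ≤ x i)
    (hSigma : unitSimplex N ⊆ (C : Set (Fin N → ℝ))) {x : ℕ → ℝ} (hx : ∀ k, 0 ≤ x k)
    (hlow : ∀ k, x k ≤ vdmSup C K w k) (hup : ∀ k, vdmSup C K w k ≤ (numPts C k).factorial * x k)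
    {L : ℝ} (hL : Tendsto (fun k : ℕ => x k ^ ((1 : ℝ) / (k * numPts C k))) atTop (𝓝 L)) :
    Tendsto (fun k : ℕ => vdmSup C K w k ^ ((1 : ℝ) / (k * numPts C k))) atTop (𝓝 L) := by
  have h2 := (tendsto_factorial_numPts_rpow hC hSigma).mul hL
  rw [one_mul] at h2
  refine tendsto_of_tendsto_of_tendsto_of_le_of_le hL h2 (fun k => ?_) (fun k => ?_)
  · exact Real.rpow_le_rpow (hx k) (hlow k) (by positivity)
  · refine (Real.rpow_le_rpow (vdmSup_nonneg k) (hup k) (by positivity)).trans_eq ?_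
    rw [Real.mul_rpow (by positivity) (hx k)]

/-- The limit of the Vandermonde determinants exists, from the lexicographic order of the
exponents. -/
theorem exists_tendsto_vdmSup (hC : ∀ x ∈ C, ∀ i, 0 ≤ x i)
    (hSigma : unitSimplex N ⊆ (C : Set (Fin N → ℝ)))
    (hK : IsCompact K) (hw : ContinuousOn w K) (hw0 : ∀ z ∈ K, 0 ≤ w z) :
    ∃ D : ℝ, Tendsto (fun k : ℕ => vdmSup C K w k ^ ((1 : ℝ) / (k * numPts C k))) atTop (𝓝 D) := by
  obtain ⟨A, hA1, hA⟩ := exists_wNorm_monomial_le C hK hw hw0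
  have hA0 : 0 < A := one_pos.trans_le hA1
  have he := linKey_injective (0 : (Fin N → ℝ) →ₗ[ℝ] ℝ)
  have hadd := linKey_add_lt (0 : (Fin N → ℝ) →ₗ[ℝ] ℝ)
  set e := linKey (0 : (Fin N → ℝ) →ₗ[ℝ] ℝ)
  set P : ℕ → ℝ := fun k => ∏ a : latticePts C k, minNorm C K w e k a / A ^ k with hP
  have hP0 : ∀ k, 0 ≤ P k := fun k =>
    Finset.prod_nonneg fun a _ => div_nonneg (minNorm_nonneg hw0 _ _) (by positivity)
  have hP1 : ∀ k, P k ≤ 1 := fun k =>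
    Finset.prod_le_one (fun a _ => div_nonneg (minNorm_nonneg hw0 _ _) (by positivity))
      fun a _ => div_le_one_of_le₀ (minNorm_le_pow hw0 hA a.2) (by positivity)
  obtain ⟨L, hL⟩ := exists_tendsto_rpow_of_le_pow N hP0 hP1 fun m k _ =>
    prod_minNorm_div_le_pow hSigma hK hw hw0 hadd hA1 hA m k
  have hprod : ∀ k, ∏ a : latticePts C k, minNorm C K w e k a = P k * (A ^ k) ^ numPts C k := by
    intro k
    rw [hP]
    simp only [Finset.prod_div_distrib, Finset.prod_const, Finset.card_univ]
    rw [numPts, div_mul_cancel₀ _ (by positivity)]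
  have hvol := volume_toReal_pos (C := C) hSigma
  have hlim := (hL.rpow ((tendsto_numPts_div hC).inv₀ hvol.ne')
    (Or.inr (inv_pos.2 hvol))).mul_const A
  refine ⟨_, tendsto_vdmSup_rpow hC hSigma (x := fun k => P k * (A ^ k) ^ numPts C k)
    (fun k => mul_nonneg (hP0 k) (by positivity))
    (fun k => ?_) (fun k => ?_) (hlim.congr' ?_)⟩
  · rw [← hprod]; exact prod_minNorm_le_vdmSup hSigma hK hw hw0 he k
  · rw [← hprod]; exact vdmSup_le_prod_minNorm hK hw hw0 he k
  · filter_upwards [eventually_ne_atTop 0] with k hk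
    have hk' : (0 : ℝ) < k := Nat.cast_pos.2 (Nat.pos_of_ne_zero hk)
    have hM : (0 : ℝ) < numPts C k := Nat.cast_pos.2 (numPts_pos hSigma k)
    rw [Real.mul_rpow (hP0 k) (by positivity), ← Real.rpow_mul (hP0 k), ← pow_mul,
      ← Real.rpow_natCast A, ← Real.rpow_mul hA0.le]
    congr 1
    · congr 1
      field_simp
      ring
    · push_cast
      rw [mul_one_div_cancel (by positivity), Real.rpow_one]

end Limit

/-! ### Bounds for the Chebyshev constants in terms of the limit -/

section Bounds

variable {C : ConvexBody (Fin N → ℝ)} {K : Set (Fin N → ℂ)} {w : (Fin N → ℂ) → ℝ}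
  {G : Type*} [LinearOrder G] {e : (Fin N →₀ ℕ) → G}

theorem limit_nonneg {D : ℝ}
    (hD : Tendsto (fun k : ℕ => vdmSup C K w k ^ ((1 : ℝ) / (k * numPts C k))) atTop (𝓝 D)) :
    0 ≤ D :=
  ge_of_tendsto' hD fun k => Real.rpow_nonneg (vdmSup_nonneg k) _

/-- In the upper bound for the Vandermonde determinant of order `2ik`, the monomials with exponents
`iα + β`, `β` in `ikC`, can be replaced by the polynomials `p ^ i z^β`. -/
theorem vdmSup_le_of_mem_monicFor (hK : IsCompact K) (hw : ContinuousOn w K)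
    (hw0 : ∀ z ∈ K, 0 ≤ w z) (he : Function.Injective e)
    (hadd : ∀ a b c, e a < e b → e (a + c) < e (b + c)) {A : ℝ} (hA1 : 1 ≤ A)
    (hA : ∀ k : ℕ, ∀ α ∈ latticePts C k, wNorm K w k (MvPolynomial.monomial α 1) ≤ A ^ k)
    {k : ℕ} {α : Fin N →₀ ℕ} (hα : α ∈ latticePts C k) {p : MvPolynomial (Fin N) ℂ}
    (hp : p ∈ monicFor C e k α) (hp1 : wNorm K w k p ≤ A ^ k) (i : ℕ) :
    vdmSup C K w (i * k + i * k) ≤ (numPts C (i * k + i * k)).factorial *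
      ((A ^ (i * k + i * k)) ^ numPts C (i * k + i * k) *
        ((wNorm K w k p / A ^ k) ^ i) ^ numPts C (i * k)) := by
  classical
  have hA0 : 0 < A := one_pos.trans_le hA1
  set n := i * k + i * k with hn
  set y := wNorm K w k p / A ^ k with hy
  have hy0 : 0 ≤ y := div_nonneg (wNorm_nonneg hw0 _ _) (by positivity)
  have hy1 : y ≤ 1 := div_le_one_of_le₀ hp1 (by positivity)
  let φ : latticePts C (i * k) → latticePts C n := fun b =>
    ⟨i • α + b, add_mem_latticePts (nsmul_mem_latticePts i hα) b.2⟩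
  have hφ : Function.Injective φ := fun b b' h =>
    Subtype.ext (add_left_cancel (congrArg Subtype.val h))
  -- the gain over the bound `A ^ n` at the exponent `a`
  let g : latticePts C n → ℝ := fun a => if a ∈ Set.range φ then y ^ i else 1
  have hg0 : ∀ a, 0 ≤ g a := fun a => by
    simp only [g]; split_ifs <;> positivity
  have hg1 : ∀ a, g a ≤ 1 := fun a => by
    simp only [g]; split_ifs
    · exact pow_le_one₀ hy0 hy1
    · exact le_rfl
  have hex : ∀ a : latticePts C n, ∃ f ∈ monicFor C e n (a : Fin N →₀ ℕ),
      wNorm K w n f ≤ A ^ n * g a := by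
    intro a
    by_cases ha : a ∈ Set.range φ
    · obtain ⟨b, rfl⟩ := ha
      refine ⟨p ^ i * MvPolynomial.monomial (b : Fin N →₀ ℕ) 1,
        mul_mem_monicFor hadd (nsmul_mem_latticePts i hα) b.2 (pow_mem_monicFor hadd hα hp i)
          (monomial_mem_monicFor _ _), ?_⟩
      refine (wNorm_mul_le hK hw hw0 _ _ _ _).trans ?_
      refine (mul_le_mul (wNorm_pow_le hK hw hw0 k p i) (hA _ _ b.2) (wNorm_nonneg hw0 _ _)
        (pow_nonneg (wNorm_nonneg hw0 _ _) _)).trans_eq ?_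
      have hgb : g (φ b) = y ^ i := if_pos ⟨b, rfl⟩
      rw [hgb, hy, div_pow, hn, pow_add, ← pow_mul, mul_comm k i]
      field_simp
    · refine ⟨_, monomial_mem_monicFor n (a : Fin N →₀ ℕ), ?_⟩
      have hga : g a = 1 := if_neg ha
      rw [hga, mul_one]
      exact hA n a a.2
  choose f hf hfn using hex
  refine (vdmSup_le_prod_wNorm hK hw hw0 he f hf).trans ?_
  refine mul_le_mul_of_nonneg_left ?_ (Nat.cast_nonneg _)
  refine (Finset.prod_le_prod (fun a _ => wNorm_nonneg hw0 _ _) fun a _ => hfn a).trans ?_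
  rw [Finset.prod_mul_distrib, Finset.prod_const, Finset.card_univ]
  refine mul_le_mul_of_nonneg_left ?_ (by positivity)
  refine (prod_le_prod_comp_of_injective hφ hg0 hg1).trans_eq ?_
  have : ∀ b, g (φ b) = y ^ i := fun b => if_pos ⟨b, rfl⟩
  simp only [this, Finset.prod_const, Finset.card_univ, numPts]

theorem tendsto_numPts_ratio (hC : ∀ x ∈ C, ∀ i, 0 ≤ x i)
    (hSigma : unitSimplex N ⊆ (C : Set (Fin N → ℝ))) :
    Tendsto (fun n : ℕ => (numPts C n : ℝ) / numPts C (n + n)) atTop (𝓝 ((2 : ℝ) ^ N)⁻¹) := by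
  have hv := volume_toReal_pos (C := C) hSigma
  have h1 := tendsto_numPts_div hC
  have h2 := h1.comp (tendsto_atTop_mono (fun n : ℕ => Nat.le_add_right n n) tendsto_id)
  have h3 := (h1.div h2 hv.ne').mul_const ((2 : ℝ) ^ N)⁻¹
  rw [div_self hv.ne', one_mul] at h3
  refine h3.congr' ?_
  filter_upwards [eventually_ne_atTop 0] with n hn
  have hn' : (0 : ℝ) < n := Nat.cast_pos.2 (Nat.pos_of_ne_zero hn)
  have hM : (0 : ℝ) < numPts C (n + n) := Nat.cast_pos.2 (numPts_pos hSigma _)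
  simp only [Function.comp, Pi.div_apply]
  have : ((n + n : ℕ) : ℝ) ^ N = 2 ^ N * (n : ℝ) ^ N := by
    rw [← mul_pow]; push_cast; ring
  rw [this]
  field_simp

theorem limit_le (hC : ∀ x ∈ C, ∀ i, 0 ≤ x i)
    (hSigma : unitSimplex N ⊆ (C : Set (Fin N → ℝ))) (hK : IsCompact K) (hw : ContinuousOn w K)
    (hw0 : ∀ z ∈ K, 0 ≤ w z) {A : ℝ} (hA1 : 1 ≤ A)
    (hA : ∀ k : ℕ, ∀ α ∈ latticePts C k, wNorm K w k (MvPolynomial.monomial α 1) ≤ A ^ k)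
    {D : ℝ}
    (hD : Tendsto (fun k : ℕ => vdmSup C K w k ^ ((1 : ℝ) / (k * numPts C k))) atTop (𝓝 D)) :
    D ≤ A := by
  have hA0 : 0 < A := one_pos.trans_le hA1
  have h1 := (tendsto_factorial_numPts_rpow hC hSigma).mul_const A
  rw [one_mul] at h1
  refine le_of_tendsto_of_tendsto hD h1 ?_
  filter_upwards [eventually_ne_atTop 0] with k hk
  have hk' : (0 : ℝ) < k := Nat.cast_pos.2 (Nat.pos_of_ne_zero hk)
  have hM : (0 : ℝ) < numPts C k := Nat.cast_pos.2 (numPts_pos hSigma k)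
  have h2 : vdmSup C K w k ≤ (numPts C k).factorial * (A ^ k) ^ numPts C k := by
    refine (vdmSup_le_prod_minNorm hK hw hw0 (keyC_injective (C := C)) k).trans ?_
    refine mul_le_mul_of_nonneg_left ?_ (Nat.cast_nonneg _)
    refine (Finset.prod_le_prod (fun a _ => minNorm_nonneg hw0 _ _)
      fun a _ => minNorm_le_pow hw0 hA a.2).trans_eq ?_
    rw [Finset.prod_const, Finset.card_univ, numPts]
  refine (Real.rpow_le_rpow (vdmSup_nonneg k) h2 (by positivity)).trans_eq ?_
  rw [Real.mul_rpow (by positivity) (by positivity), ← pow_mul, ← Real.rpow_natCast A,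
    ← Real.rpow_mul hA0.le]
  push_cast
  rw [mul_one_div_cancel (by positivity), Real.rpow_one]

/-- A uniform lower bound for the weighted norms of polynomials that are monic for an order
compatible with addition. -/
theorem mul_pow_le_wNorm (hC : ∀ x ∈ C, ∀ i, 0 ≤ x i)
    (hSigma : unitSimplex N ⊆ (C : Set (Fin N → ℝ))) (hK : IsCompact K) (hw : ContinuousOn w K)
    (hw0 : ∀ z ∈ K, 0 ≤ w z) (he : Function.Injective e)
    (hadd : ∀ a b c, e a < e b → e (a + c) < e (b + c)) {A : ℝ} (hA1 : 1 ≤ A)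
    (hA : ∀ k : ℕ, ∀ α ∈ latticePts C k, wNorm K w k (MvPolynomial.monomial α 1) ≤ A ^ k)
    {D : ℝ}
    (hD : Tendsto (fun k : ℕ => vdmSup C K w k ^ ((1 : ℝ) / (k * numPts C k))) atTop (𝓝 D))
    {k : ℕ} (hk : k ≠ 0) {α : Fin N →₀ ℕ} (hα : α ∈ latticePts C k)
    {p : MvPolynomial (Fin N) ℂ} (hp : p ∈ monicFor C e k α) :
    (A * (D / A) ^ 2 ^ (N + 1)) ^ k ≤ wNorm K w k p := by
  have hA0 : 0 < A := one_pos.trans_le hA1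
  have hk' : (0 : ℝ) < k := Nat.cast_pos.2 (Nat.pos_of_ne_zero hk)
  have hD0 := limit_nonneg hD
  have hDA : D / A ≤ 1 := div_le_one_of_le₀ (limit_le hC hSigma hK hw hw0 hA1 hA hD) hA0.le
  have hDA0 : 0 ≤ D / A := div_nonneg hD0 hA0.le
  rw [mul_pow, ← le_div_iff₀' (by positivity)]
  set y := wNorm K w k p / A ^ k with hy
  have hy0 : 0 ≤ y := div_nonneg (wNorm_nonneg hw0 _ _) (by positivity)
  rcases le_total (A ^ k) (wNorm K w k p) with hbig | hsmall
  · have : 1 ≤ y := (one_le_div (by positivity)).2 hbig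
    exact (pow_le_one₀ (by positivity) (pow_le_one₀ hDA0 hDA)).trans this
  have hsub : Tendsto (fun i : ℕ => i * k) atTop atTop :=
    tendsto_id.atTop_mul_const' (Nat.pos_of_ne_zero hk)
  have hsub2 : Tendsto (fun i : ℕ => i * k + i * k) atTop atTop := 
    tendsto_atTop_mono (fun i => Nat.le_add_right (i * k) (i * k)) hsub
  have hexp : Tendsto (fun i : ℕ =>
      (1 / (2 * k : ℝ)) * ((numPts C (i * k) : ℝ) / numPts C (i * k + i * k))) atTop
      (𝓝 ((1 / (2 * k : ℝ)) * ((2 : ℝ) ^ N)⁻¹)) :=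
    ((tendsto_numPts_ratio hC hSigma).comp hsub).const_mul _
  have hup := ((((tendsto_factorial_numPts_rpow hC hSigma).comp hsub2).mul_const A).mul
    ((tendsto_const_nhds (x := y)).rpow hexp (Or.inr (by positivity))))
  rw [one_mul] at hup
  have hle : D ≤ A * y ^ ((1 / (2 * k : ℝ)) * ((2 : ℝ) ^ N)⁻¹) := by
    refine le_of_tendsto_of_tendsto (hD.comp hsub2) hup ?_
    filter_upwards [eventually_ne_atTop 0] with i hi
    have hi' : (0 : ℝ) < i := Nat.cast_pos.2 (Nat.pos_of_ne_zero hi)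
    have hM : (0 : ℝ) < numPts C (i * k + i * k) := Nat.cast_pos.2 (numPts_pos hSigma _)
    have h1 := vdmSup_le_of_mem_monicFor hK hw hw0 he hadd hA1 hA hα hp hsmall i
    simp only [Function.comp]
    refine (Real.rpow_le_rpow (vdmSup_nonneg _) h1 (by positivity)).trans_eq ?_
    rw [Real.mul_rpow (by positivity) (by positivity),
      Real.mul_rpow (by positivity) (by positivity), mul_assoc]
    congr 1
    rw [← pow_mul, ← pow_mul, ← Real.rpow_natCast A, ← Real.rpow_natCast y,
      ← Real.rpow_mul hA0.le, ← Real.rpow_mul hy0]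
    congr 1
    · push_cast
      rw [mul_one_div_cancel (by positivity), Real.rpow_one]
    · congr 1
      push_cast
      field_simp
      ring
  have hle' : D / A ≤ y ^ ((1 / (2 * k : ℝ)) * ((2 : ℝ) ^ N)⁻¹) := by
    rwa [div_le_iff₀' hA0]
  have hpow := pow_le_pow_left₀ hDA0 hle' (2 ^ (N + 1) * k)
  rw [pow_mul] at hpow
  refine hpow.trans_eq ?_
  rw [← Real.rpow_natCast (y ^ _), ← Real.rpow_mul hy0]
  have : (1 / (2 * k : ℝ)) * ((2 : ℝ) ^ N)⁻¹ * ((2 ^ (N + 1) * k : ℕ) : ℝ) = 1 := by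
    push_cast
    rw [pow_succ]
    field_simp
  rw [this, Real.rpow_one]

theorem chebC_nonneg (hw0 : ∀ z ∈ K, 0 ≤ w z) (k : ℕ) (α : Fin N →₀ ℕ) :
    0 ≤ chebC C K w k α := by
  rw [chebC_eq]
  exact Real.rpow_nonneg (minNorm_nonneg hw0 _ _) _

theorem chebC_pow (hw0 : ∀ z ∈ K, 0 ≤ w z) {k : ℕ} (hk : k ≠ 0) (α : Fin N →₀ ℕ) :
    chebC C K w k α ^ k = minNorm C K w (keyC C) k α := by
  rw [chebC_eq, one_div, Real.rpow_inv_natCast_pow (minNorm_nonneg hw0 _ _) hk]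

theorem chebC_le (hw0 : ∀ z ∈ K, 0 ≤ w z) {A : ℝ} (hA1 : 1 ≤ A)
    (hA : ∀ k : ℕ, ∀ α ∈ latticePts C k, wNorm K w k (MvPolynomial.monomial α 1) ≤ A ^ k)
    {k : ℕ} (hk : k ≠ 0) {α : Fin N →₀ ℕ} (hα : α ∈ latticePts C k) :
    chebC C K w k α ≤ A := by
  refine le_of_pow_le_pow_left₀ hk (zero_le_one.trans hA1) ?_
  rw [chebC_pow hw0 hk]
  exact minNorm_le_pow hw0 hA hα

/-- A lower bound for the constants `T_k^C(α)` that is uniform in `k` and `α`. It is positive when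
the limit `D` of the Vandermonde determinants is. -/
theorem le_chebC (hC : ∀ x ∈ C, ∀ i, 0 ≤ x i)
    (hSigma : unitSimplex N ⊆ (C : Set (Fin N → ℝ))) (hK : IsCompact K) (hw : ContinuousOn w K)
    (hw0 : ∀ z ∈ K, 0 ≤ w z) {A : ℝ} (hA1 : 1 ≤ A)
    (hA : ∀ k : ℕ, ∀ α ∈ latticePts C k, wNorm K w k (MvPolynomial.monomial α 1) ≤ A ^ k)
    {D : ℝ}
    (hD : Tendsto (fun k : ℕ => vdmSup C K w k ^ ((1 : ℝ) / (k * numPts C k))) atTop (𝓝 D))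
    {k : ℕ} (hk : k ≠ 0) {α : Fin N →₀ ℕ} (hα : α ∈ latticePts C k) :
    A * (D / A) ^ 2 ^ (N + 1) ≤ chebC C K w k α := by
  refine le_of_pow_le_pow_left₀ hk (chebC_nonneg hw0 k α) ?_
  rw [chebC_pow hw0 hk]
  refine le_of_forall_monicFor hw0 (g := id) continuous_id fun p hp => ?_
  rw [monicFor_keyC] at hp
  obtain ⟨f, hf⟩ := exists_mem_monicFor_linKey hSigma hp
  exact mul_pow_le_wNorm hC hSigma hK hw hw0 (linKey_injective f) (linKey_add_lt f) hA1 hA hD hk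
    hα hf

end Bounds

/-! ### Directions with a positive Chebyshev constant -/

section Positive

variable {C : ConvexBody (Fin N → ℝ)} {K : Set (Fin N → ℂ)} {w : (Fin N → ℂ) → ℝ}

/-- Multiplication by `z^δ` turns the order `≺_C`, shifted by `δ`, into `≺_C`. -/
theorem minNorm_keyC_add_le (hK : IsCompact K) (hw : ContinuousOn w K)
    (hw0 : ∀ z ∈ K, 0 ≤ w z) {A : ℝ}
    (hA : ∀ k : ℕ, ∀ α ∈ latticePts C k, wNorm K w k (MvPolynomial.monomial α 1) ≤ A ^ k)
    {k l : ℕ} {α δ : Fin N →₀ ℕ} (hδ : δ ∈ latticePts C l) :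
    minNorm C K w (keyC C) (k + l) (α + δ) ≤
      minNorm C K w (fun a => keyC C (a + δ)) k α * A ^ l := by
  classical
  refine le_of_forall_monicFor hw0 (g := fun y => y * A ^ l) (by fun_prop) fun p hp => ?_
  have hmem : p * MvPolynomial.monomial δ 1 ∈ monicFor C (keyC C) (k + l) (α + δ) := by
    refine ⟨by rw [MvPolynomial.coeff_mul_monomial, hp.1, mul_one], fun β hβ hne => ?_⟩
    obtain ⟨b, hb, c, hc, rfl⟩ := Finset.mem_add.1 (MvPolynomial.support_mul _ _ hβ)
    obtain rfl := Finset.mem_singleton.1 (MvPolynomial.support_monomial_subset hc)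
    have := hp.2 b hb fun h => hne (by rw [h])
    exact ⟨add_mem_latticePts this.1 hδ, this.2⟩
  refine (minNorm_le hw0 hmem).trans ((wNorm_mul_le hK hw hw0 _ _ _ _).trans ?_)
  exact mul_le_mul_of_nonneg_left (hA l δ hδ) (wNorm_nonneg hw0 _ _)

/-- An eventual property along `dirFilter C θ` holds for all large `k` and all directions in a
neighbourhood of `θ`, uniformly. -/
theorem exists_forall_of_eventually_dirFilter {θ : Fin N → ℝ} {p : ℕ × (Fin N →₀ ℕ) → Prop}
    (h : ∀ᶠ x in dirFilter C θ, p x) :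
    ∃ k₀ : ℕ, ∃ ε > 0, ∀ k ≥ k₀, ∀ α ∈ latticePts C k,
      ‖(k : ℝ)⁻¹ • expPt α - θ‖ < ε → p (k, α) := by
  have hb := ((atTop_basis.comap (Prod.fst : ℕ × (Fin N →₀ ℕ) → ℕ)).inf
    (Metric.nhds_basis_ball.comap (fun x : ℕ × (Fin N →₀ ℕ) => (x.1 : ℝ)⁻¹ • expPt x.2)
      (l := 𝓝 θ))).inf_principal {x : ℕ × (Fin N →₀ ℕ) | x.2 ∈ latticePts C x.1}
  obtain ⟨⟨k₀, ε⟩, ⟨-, hε⟩, hs⟩ := hb.eventually_iff.1 h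
  refine ⟨k₀, ε, hε, fun k hk α hα hn => hs ⟨⟨hk, ?_⟩, hα⟩⟩
  exact mem_ball_iff_norm.2 hn

theorem dirFilter_neBot (hC : ∀ x ∈ C, ∀ i, 0 ≤ x i) {θ : Fin N → ℝ}
    (hint : θ ∈ interior (C : Set (Fin N → ℝ))) : (dirFilter C θ).NeBot :=
  (tendsto_floorPt_dirFilter hC hint).neBot

/-- If the Chebyshev constant in one interior direction `θ` is positive, then so is the limit of
the Vandermonde determinants: the points `α + δ`, with `α` in `kC` and `δ` near `skθ` for a large
fixed `s`, all have directions close to `θ`, and their Chebyshev constants bound those of the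
points `α` for the shifted order from below. -/
theorem limit_pos_of_isDirChebC (hC : ∀ x ∈ C, ∀ i, 0 ≤ x i)
    (hSigma : unitSimplex N ⊆ (C : Set (Fin N → ℝ))) (hK : IsCompact K) (hw : ContinuousOn w K)
    (hw0 : ∀ z ∈ K, 0 ≤ w z) {D : ℝ}
    (hD : Tendsto (fun k : ℕ => vdmSup C K w k ^ ((1 : ℝ) / (k * numPts C k))) atTop (𝓝 D))
    {θ : Fin N → ℝ} (hint : θ ∈ interior (C : Set (Fin N → ℝ))) {t : ℝ} (ht : 0 < t)
    (hθ : IsDirChebC C K w θ t) : 0 < D := by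
  obtain ⟨A, hA1, hA⟩ := exists_wNorm_monomial_le C hK hw hw0
  have hA0 : 0 < A := one_pos.trans_le hA1
  have h0 := hC θ (interior_subset hint)
  obtain ⟨k₀, ε, hε, hk₀⟩ := exists_forall_of_eventually_dirFilter
    (hθ.eventually (lt_mem_nhds (half_lt_self ht)))
  obtain ⟨R, hR⟩ := C.isCompact.isBounded.exists_norm_le
  obtain ⟨s, hs⟩ := exists_nat_gt ((R + ‖θ‖ + 1) / ε)
  have hR0 : 0 ≤ R := (norm_nonneg θ).trans (hR θ (interior_subset hint))
  have hspos : 0 < s := Nat.cast_pos.1 (lt_of_le_of_lt (by positivity) hs)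
  have hsε : (R + ‖θ‖ + 1) < ε * (1 + s) := by
    rw [div_lt_iff₀ hε] at hs
    linarith
  set c := (t / 2) ^ (1 + s) / A ^ s with hc
  have hcpos : 0 < c := by positivity
  refine hcpos.trans_le (ge_of_tendsto hD ?_)
  have hsub : Tendsto (fun k : ℕ => s * k) atTop atTop := tendsto_id.const_mul_atTop' hspos
  filter_upwards [hsub.eventually (eventually_floorPt_mem h0 hint), eventually_ge_atTop k₀,
    eventually_ne_atTop 0] with k hδ hkk hk
  have hk' : (0 : ℝ) < k := Nat.cast_pos.2 (Nat.pos_of_ne_zero hk)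
  have hk1 : (1 : ℝ) ≤ k := by exact_mod_cast Nat.one_le_iff_ne_zero.2 hk
  have hM : (0 : ℝ) < numPts C k := Nat.cast_pos.2 (numPts_pos hSigma k)
  have hsk : s * k ≠ 0 := Nat.mul_ne_zero hspos.ne' hk
  have hsk' : (0 : ℝ) < ((s * k : ℕ) : ℝ) := Nat.cast_pos.2 (Nat.pos_of_ne_zero hsk)
  have hkl : k + s * k ≠ 0 := by omega
  set δ := floorPt (s * k) θ with hδdef
  have hdir : ∀ α ∈ latticePts C k,
      ‖((k + s * k : ℕ) : ℝ)⁻¹ • expPt (α + δ) - θ‖ < ε := by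
    intro α hα
    have h1 : ‖(k : ℝ)⁻¹ • expPt α - θ‖ ≤ R + ‖θ‖ :=
      (norm_sub_le _ _).trans (add_le_add_left (hR _ ((mem_latticePts_iff hk).1 hα)) _)
    have h2 : ‖((s * k : ℕ) : ℝ)⁻¹ • expPt δ - θ‖ ≤ ((s * k : ℕ) : ℝ)⁻¹ :=
      norm_sub_le_of_mem_cube hsk ((mem_cube_iff hsk).2 ⟨h0, rfl⟩)
    have hkl' : (0 : ℝ) < ((k + s * k : ℕ) : ℝ) := Nat.cast_pos.2 (Nat.pos_of_ne_zero hkl)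
    have hdecomp : ((k + s * k : ℕ) : ℝ)⁻¹ • expPt (α + δ) - θ =
        ((k + s * k : ℕ) : ℝ)⁻¹ • ((k : ℝ) • ((k : ℝ)⁻¹ • expPt α - θ) +
          ((s * k : ℕ) : ℝ) • (((s * k : ℕ) : ℝ)⁻¹ • expPt δ - θ)) := by
      have hθ' : θ = ((k + s * k : ℕ) : ℝ)⁻¹ • (((k : ℝ) + ((s * k : ℕ) : ℝ)) • θ) := by
        rw [← Nat.cast_add, inv_smul_smul₀ hkl'.ne']
      conv_lhs => rw [hθ']
      rw [smul_sub, smul_sub, smul_inv_smul₀ hk'.ne', smul_inv_smul₀ hsk'.ne', ← smul_sub,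
        expPt_add, add_smul]
      congr 1
      abel
    rw [hdecomp, norm_smul, norm_inv, Real.norm_of_nonneg hkl'.le, inv_mul_lt_iff₀ hkl']
    refine (norm_add_le _ _).trans_lt ?_
    rw [norm_smul, norm_smul, Real.norm_of_nonneg hk'.le, Real.norm_of_nonneg hsk'.le]
    have h3 : ((s * k : ℕ) : ℝ) * ‖((s * k : ℕ) : ℝ)⁻¹ • expPt δ - θ‖ ≤ 1 :=
      (mul_le_mul_of_nonneg_left h2 hsk'.le).trans_eq (mul_inv_cancel₀ hsk'.ne')
    have h4 := mul_le_mul_of_nonneg_left h1 hk'.le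
    have h5 := mul_lt_mul_of_pos_left hsε hk'
    have h6 : ((k + s * k : ℕ) : ℝ) * ε = k * (ε * (1 + s)) := by push_cast; ring
    rw [h6]
    linarith
  have hlow : ∀ a : latticePts C k, c ^ k ≤
      minNorm C K w (fun b => keyC C (b + δ)) k (a : Fin N →₀ ℕ) := by
    intro a
    have h1 := hk₀ (k + s * k) (by nlinarith) _ (add_mem_latticePts a.2 hδ) (hdir a a.2)
    have h2 := pow_le_pow_left₀ (by positivity) h1.le (k + s * k)
    rw [chebC_pow hw0 hkl] at h2
    have h3 := h2.trans (minNorm_keyC_add_le hK hw hw0 hA hδ)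
    rw [hc, div_pow, ← pow_mul, ← pow_mul, div_le_iff₀ (by positivity)]
    refine (le_of_eq ?_).trans h3
    congr 1
    ring
  have hprod : (c ^ k) ^ numPts C k ≤ vdmSup C K w k := by
    refine le_trans ?_ (prod_minNorm_le_vdmSup hSigma hK hw hw0
      (e := fun b => keyC C (b + δ)) (fun a b h => add_right_cancel (keyC_injective h)) k)
    rw [numPts, ← Finset.card_univ, ← Finset.prod_const]
    exact Finset.prod_le_prod (fun _ _ => by positivity) fun a _ => hlow a
  refine (le_of_eq ?_).trans (Real.rpow_le_rpow (by positivity) hprod (by positivity))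
  rw [← pow_mul, ← Real.rpow_natCast c, ← Real.rpow_mul hcpos.le]
  push_cast
  rw [mul_one_div_cancel (by positivity), Real.rpow_one]

end Positive

/-! ### The integral formula -/

section Formula

variable {C : ConvexBody (Fin N → ℝ)} {K : Set (Fin N → ℂ)} {w : (Fin N → ℂ) → ℝ}

theorem elog_of_pos {t : ℝ} (ht : 0 < t) : elog t = ((Real.log t : ℝ) : EReal) := by
  rw [elog, ENNReal.log_ofReal_of_pos ht]

theorem elog_zero : elog 0 = ⊥ := by
  simp [elog]

/-- If all directional constants vanish, the integral of their logarithms is `-∞`. -/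
theorem eintegral_eq_bot {μ : Measure (Fin N → ℝ)} (hμ : μ ≠ 0) {T : (Fin N → ℝ) → ℝ}
    (hT : ∀ᵐ θ ∂μ, T θ = 0) : eintegral μ (fun θ => elog (T θ)) = ⊥ := by
  have h1 : ∫⁻ θ, (elog (T θ)).toENNReal ∂μ = 0 := by
    rw [lintegral_congr_ae (g := fun _ => 0)]
    · simp
    · filter_upwards [hT] with θ hθ
      rw [hθ, elog_zero]
      simp
  have h2 : ∫⁻ θ, (-elog (T θ)).toENNReal ∂μ = ⊤ := by
    rw [lintegral_congr_ae (g := fun _ => ⊤)]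
    · rw [lintegral_const, ENNReal.top_mul]
      simpa using hμ
    · filter_upwards [hT] with θ hθ
      rw [hθ, elog_zero]
      simp
  rw [eintegral, h1, h2]
  simp

theorem eintegral_eq_integral {μ : Measure (Fin N → ℝ)} {T : (Fin N → ℝ) → ℝ}
    (hT : ∀ᵐ θ ∂μ, 0 < T θ) (hint : Integrable (fun θ => Real.log (T θ)) μ) :
    eintegral μ (fun θ => elog (T θ)) = ((∫ θ, Real.log (T θ) ∂μ : ℝ) : EReal) := by
  have h1 : ∫⁻ θ, (elog (T θ)).toENNReal ∂μ = ∫⁻ θ, ENNReal.ofReal (Real.log (T θ)) ∂μ := by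
    refine lintegral_congr_ae ?_
    filter_upwards [hT] with θ hθ
    rw [elog_of_pos hθ, EReal.toENNReal_of_ne_top (EReal.coe_ne_top _), EReal.toReal_coe]
  have h2 : ∫⁻ θ, (-elog (T θ)).toENNReal ∂μ = ∫⁻ θ, ENNReal.ofReal (-Real.log (T θ)) ∂μ := by
    refine lintegral_congr_ae ?_
    filter_upwards [hT] with θ hθ
    rw [elog_of_pos hθ, ← EReal.coe_neg, EReal.toENNReal_of_ne_top (EReal.coe_ne_top _),
      EReal.toReal_coe]
  have f1 : ∫⁻ θ, ENNReal.ofReal (Real.log (T θ)) ∂μ ≠ ⊤ :=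
    hint.lintegral_lt_top.ne
  have f2 : ∫⁻ θ, ENNReal.ofReal (-Real.log (T θ)) ∂μ ≠ ⊤ :=
    hint.neg.lintegral_lt_top.ne
  rw [eintegral, h1, h2, integral_eq_lintegral_pos_part_sub_lintegral_neg_part hint,
    EReal.coe_sub, EReal.coe_ennreal_toReal f1, EReal.coe_ennreal_toReal f2]

/-- The integral formula when the limit is positive: the Chebyshev constants of finite order are
then bounded away from `0` and `∞`, so that the averages of their logarithms converge to the
average of the logarithm of the directional constants. -/
theorem limit_eq_exp_integral (hC : ∀ x ∈ C, ∀ i, 0 ≤ x i)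
    (hSigma : unitSimplex N ⊆ (C : Set (Fin N → ℝ))) (hK : IsCompact K) (hw : ContinuousOn w K)
    (hw0 : ∀ z ∈ K, 0 ≤ w z) {D : ℝ}
    (hD : Tendsto (fun k : ℕ => vdmSup C K w k ^ ((1 : ℝ) / (k * numPts C k))) atTop (𝓝 D))
    (hDpos : 0 < D) {T : (Fin N → ℝ) → ℝ}
    (hT : ∀ᵐ θ ∂(volume.restrict (interior (C : Set (Fin N → ℝ)))), IsDirChebC C K w θ (T θ)) :
    (∀ᵐ θ ∂(volume.restrict (interior (C : Set (Fin N → ℝ)))), 0 < T θ) ∧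
      IntegrableOn (fun θ => Real.log (T θ)) (interior (C : Set (Fin N → ℝ))) ∧
      D = Real.exp ((volume (C : Set (Fin N → ℝ))).toReal⁻¹ *
        ∫ θ in interior (C : Set (Fin N → ℝ)), Real.log (T θ)) := by
  obtain ⟨A, hA1, hA⟩ := exists_wNorm_monomial_le C hK hw hw0
  have hA0 : 0 < A := one_pos.trans_le hA1
  set lo := A * (D / A) ^ 2 ^ (N + 1) with hlo
  have hlo0 : 0 < lo := by positivity
  have hge : ∀ k, k ≠ 0 → ∀ α ∈ latticePts C k, lo ≤ chebC C K w k α := fun k hk α hα =>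
    le_chebC hC hSigma hK hw hw0 hA1 hA hD hk hα
  have hle : ∀ k, k ≠ 0 → ∀ α ∈ latticePts C k, chebC C K w k α ≤ A := fun k hk α hα =>
    chebC_le hw0 hA1 hA hk hα
  set B := max |Real.log lo| |Real.log A| with hB
  have hlogB : ∀ t, lo ≤ t → t ≤ A → |Real.log t| ≤ B := by
    intro t h1 h2
    exact abs_le_max_abs_abs (Real.log_le_log hlo0 h1) (Real.log_le_log (hlo0.trans_le h1) h2)
  have hTbd : ∀ᵐ θ ∂(volume.restrict (interior (C : Set (Fin N → ℝ)))),
      lo ≤ T θ ∧ T θ ≤ A := by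
    filter_upwards [hT, ae_restrict_mem isOpen_interior.measurableSet] with θ hθ hint
    have := dirFilter_neBot hC hint
    have hev : ∀ᶠ x in dirFilter C θ, lo ≤ chebC C K w x.1 x.2 ∧ chebC C K w x.1 x.2 ≤ A := by
      have h1 : ∀ᶠ x in dirFilter C θ, x.2 ∈ latticePts C x.1 :=
        mem_inf_of_right (mem_principal_self _)
      have h2 : ∀ᶠ x in dirFilter C θ, x.1 ≠ 0 :=
        (tendsto_comap.eventually (eventually_ne_atTop 0)).filter_mono
          (inf_le_left.trans inf_le_left)
      filter_upwards [h1, h2] with x hx hx0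
      exact ⟨hge _ hx0 _ hx, hle _ hx0 _ hx⟩
    exact ⟨ge_of_tendsto hθ (hev.mono fun _ h => h.1), le_of_tendsto hθ (hev.mono fun _ h => h.2)⟩
  have hlog : ∀ᵐ θ ∂(volume.restrict (interior (C : Set (Fin N → ℝ)))),
      Tendsto (fun x : ℕ × (Fin N →₀ ℕ) => Real.log (chebC C K w x.1 x.2)) (dirFilter C θ)
        (𝓝 (Real.log (T θ))) := by
    filter_upwards [hT, hTbd] with θ hθ hbd
    exact Tendsto.log hθ (hlo0.trans_le hbd.1).ne'
  have hvol := volume_toReal_pos (C := C) hSigma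
  refine ⟨hTbd.mono fun θ h => hlo0.trans_le h.1, ?_, ?_⟩
  · have hfin : volume (interior (C : Set (Fin N → ℝ))) ≠ ⊤ := by
      rw [volume_interior]; exact C.isCompact.measure_lt_top.ne
    refine Integrable.mono' (g := fun _ => B) (integrableOn_const hfin)
      (aemeasurable_of_dirLimit hC (h := fun k α => Real.log (chebC C K w k α))
        hlog).aestronglyMeasurable ?_
    filter_upwards [hTbd] with θ h
    exact hlogB _ h.1 h.2
  · have hsum := tendsto_sum_latticePts_div hC (B := B) (le_max_of_le_left (abs_nonneg _))
      (h := fun k α => Real.log (chebC C K w k α))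
      (fun k hk α hα => hlogB _ (hge k hk α hα) (hle k hk α hα)) hlog
    have hlim := (((tendsto_numPts_div hC).inv₀ hvol.ne').mul hsum).rexp
    refine tendsto_nhds_unique hD (tendsto_vdmSup_rpow hC hSigma
      (x := fun k => ∏ a : latticePts C k, minNorm C K w (keyC C) k a)
      (fun k => Finset.prod_nonneg fun a _ => minNorm_nonneg hw0 _ _)
      (prod_minNorm_le_vdmSup hSigma hK hw hw0 keyC_injective)
      (vdmSup_le_prod_minNorm hK hw hw0 keyC_injective) (hlim.congr' ?_))
    filter_upwards [eventually_ne_atTop 0] with k hk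
    have hk' : (0 : ℝ) < k := Nat.cast_pos.2 (Nat.pos_of_ne_zero hk)
    have hM : (0 : ℝ) < numPts C k := Nat.cast_pos.2 (numPts_pos hSigma k)
    have hpos : ∀ a : latticePts C k, 0 < chebC C K w k a := fun a =>
      hlo0.trans_le (hge k hk a a.2)
    simp only [← chebC_pow hw0 hk]
    rw [Finset.prod_pow, Real.rpow_def_of_pos (by
      exact pow_pos (Finset.prod_pos fun a _ => hpos a) k), Real.log_pow,
      Real.log_prod (fun a _ => (hpos a).ne')]
    congr 1
    field_simp

end Formula

end CPluri

theorem theorem4p5 {N : ℕ} (C : ConvexBody (Fin N → ℝ))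
    (hC : ∀ x ∈ C, ∀ i, 0 ≤ x i)
    (hSigma : CPluri.unitSimplex N ⊆ (C : Set (Fin N → ℝ)))
    (hdag : CPluri.Dagger C)
    (K : Set (Fin N → ℂ)) (hK : IsCompact K)
    (w : (Fin N → ℂ) → ℝ) (hw : ContinuousOn w K) (hw0 : ∀ z ∈ K, 0 ≤ w z) :
    ∃ D : ℝ,
      Tendsto (fun k : ℕ => CPluri.vdmSup C K w k ^ ((1 : ℝ) / (k * CPluri.numPts C k)))
        atTop (𝓝 D) ∧
      ∀ T : (Fin N → ℝ) → ℝ,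
        (∀ᵐ θ ∂(volume.restrict (interior (C : Set (Fin N → ℝ)))),
          CPluri.IsDirChebC C K w θ (T θ)) →
        ENNReal.ofReal D =
          EReal.exp ((((volume (C : Set (Fin N → ℝ))).toReal⁻¹ : ℝ) : EReal) *
            CPluri.eintegral (volume.restrict (interior (C : Set (Fin N → ℝ))))
              (fun θ => CPluri.elog (T θ))) := by
  obtain ⟨D, hD⟩ := CPluri.exists_tendsto_vdmSup hC hSigma hK hw hw0
  refine ⟨D, hD, fun T hT => ?_⟩
  rcases (CPluri.limit_nonneg hD).eq_or_lt with h0 | hpos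
  · have hT0 : ∀ᵐ θ ∂(volume.restrict (interior (C : Set (Fin N → ℝ)))), T θ = 0 := by
      filter_upwards [hT, ae_restrict_mem isOpen_interior.measurableSet] with θ hθ hint
      have := CPluri.dirFilter_neBot hC hint
      have hnn : 0 ≤ T θ := ge_of_tendsto' hθ fun x => CPluri.chebC_nonneg hw0 _ _
      by_contra hne
      have := CPluri.limit_pos_of_isDirChebC hC hSigma hK hw hw0 hD hint
        (lt_of_le_of_ne hnn (Ne.symm hne)) hθ
      exact this.ne h0
    have hμ : volume.restrict (interior (C : Set (Fin N → ℝ))) ≠ 0 := by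
      rw [Ne, Measure.restrict_eq_zero]
      exact (isOpen_interior.measure_pos volume (CPluri.interior_nonempty hSigma)).ne'
    rw [CPluri.eintegral_eq_bot hμ hT0, ← h0,
      EReal.coe_mul_bot_of_pos (inv_pos.2 (CPluri.volume_toReal_pos hSigma))]
    simp
  · obtain ⟨hTpos, hint, hDeq⟩ :=
      CPluri.limit_eq_exp_integral hC hSigma hK hw hw0 hD hpos hT
    rw [CPluri.eintegral_eq_integral hTpos hint, ← EReal.coe_mul, EReal.exp_coe, ← hDeq]
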